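/- For a probability measure $\eta$ on $\mathbb R$ let $F_\eta(x)=\eta((-\infty,x])$, $F_\eta(x_-)=\eta((-\infty,x))$, and $F_\eta^{-1}(u)=\inf\{x: F_\eta(x)\ge u\}$ for $u\in(0,1)$. Let $\mu,\nu$ be probability measures on $\mathbb R$ with finite first moments. Write $\mu\le_{dcx}\nu$ (resp. $\mu\le_{icx}\nu$) if $\int f\,d\mu\le\int f\,d\nu$ (in $(-\infty,+\infty]$) for every nonincreasing (resp. nondecreasing) convex $f:\mathbb R\to\mathbb R$. A measure $M(dx,dy)=\mu(dx)\,m(x,dy)$, with $m$ a Markov kernel, is a supermartingale (resp. submartingale) coupling between $\mu$ and $\nu$ if its marginals are $\mu$ and $\nu$ and, for $\mu$-a.e. $x$, $\int|y|\,m(x,dy)<\infty$ and $\int y\,m(x,dy)\le x$ (resp. $\ge x$). For $u\in[0,1]$ let $\Psi_\pm(u)=\int_0^u(F_\mu^{-1}-F_\nu^{-1})^\pm(v)\,dv$, let $\widetilde\varphi(u)=\inf\{r\in[0,1]:\Psi_+(r)\ge\Psi_-(u)\}$, $u_d=\widetilde\varphi(1)$, $\gamma_d=\Psi_+(u_d)$,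 and for $u\in(0,u_d)$ let $\varphi(u)=\inf\{r\in[0,1]:\Psi_-(r)\ge\Psi_+(u)\}$. If $u_d>0$, let $\mathcal Q^d$ be the set of probability measures $Q$ on $(0,u_d)\times(0,1)$ with first marginal $\frac1{\gamma_d}(F_\mu^{-1}-F_\nu^{-1})^+(u)\,du$, second marginal $\frac1{\gamma_d}(F_\mu^{-1}-F_\nu^{-1})^-(v)\,dv$, and $Q(\{(u,v):u<v\})=1$. Disintegration kernels of $Q\in\mathcal Q^d$ are sub-Markov kernels $\pi_+$ (from $(0,u_d)$ to $(0,1)$) and $\pi_-$ (from $(0,1)$ to $(0,u_d)$) with $$Q(du,dv)=\tfrac1{\gamma_d}(F_\mu^{-1}-F_\nu^{-1})^+(u)\,du\,\pi_+(u,dv)=\tfrac1{\gamma_d}(F_\mu^{-1}-F_\nu^{-1})^-(v)\,dv\,\pi_-(v,du).$$ For a measure $\kappa$ and $u\in(0,1)$ put $$T_u\kappa(dy)=\int\frac{F_\mu^{-1}(u)-F_\nu^{-1}(u)}{F_\nu^{-1}(v)-F_\nu^{-1}(u)}\,\delta_{F_\nu^{-1}(v)}(dy)\,\kappa(dv)+\Big(\int\frac{F_\nu^{-1}(v)-F_\mu^{-1}(u)}{F_\nu^{-1}(v)-F_\nu^{-1}(u)}\,\kappa(dv)\Big)\delta_{F_\nu^{-1}(u)}(dy).$$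 Let $\widetilde m^{Q}(u,\cdot)$ be $T_u\pi_+(u,\cdot)$ if $u<u_d$, $F_\mu^{-1}(u)>F_\nu^{-1}(u)$ and $\pi_+(u,\{v:F_\nu^{-1}(v)>F_\mu^{-1}(u)\})=1$; $T_u\pi_-(u,\cdot)$ if $F_\mu^{-1}(u)<F_\nu^{-1}(u)$ and $\pi_-(u,\{v:F_\nu^{-1}(v)<F_\mu^{-1}(u)\})=1$; and $\delta_{F_\nu^{-1}(u)}$ otherwise. For a kernel $\widetilde m$ on $(0,1)$, let the associated kernel $m$ on $\mathbb R$ be: $m(x,\cdot)=\delta_x$ if $F_\mu(x)=0$ or $F_\mu(x_-)=1$; $m(x,\cdot)=\frac1{\mu(\{x\})}\int_{F_\mu(x_-)}^{F_\mu(x)}\widetilde m(u,\cdot)\,du$ if $\mu(\{x\})>0$; and $m(x,\cdot)=\widetilde m(F_\mu(x),\cdot)$ otherwise. Let $m^Q$ be associated to $\widetilde m^Q$. Finally let $$Q^{ITS}(du,dv)=\tfrac1{\gamma_d}(F_\mu^{-1}-F_\nu^{-1})^+(u)\,du\,\pi^{ITS}_+(u,dv),\qquad \pi_+^{ITS}(u,dv)=\mathbf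 1_{\{0<\varphi(u)<1\}}\delta_{\varphi(u)}(dv),\quad u\in(0,u_d).$$ **Part 1.** Suppose $\mu\le_{dcx}\nu$ and $u_d>0$. (a) Every $Q\in\mathcal Q^d$ admits disintegration kernels and, for every choice of them, $m^Q$ is a Markov kernel and $\mu(dx)\,m^Q(x,dy)$ is a supermartingale coupling between $\mu$ and $\nu$. (b) $Q^{ITS}\in\mathcal Q^d$. Moreover $Q^{ITS}(du,dv)=\frac1{\gamma_d}(F_\mu^{-1}-F_\nu^{-1})^-(v)\,dv\,\pi_-^{ITS}(v,du)$ with $\pi_-^{ITS}(v,du)=\mathbf 1_{\{0<\widetilde\varphi(v)<u_d\}}\delta_{\widetilde\varphi(v)}(du)$. (c) With the disintegration kernels $\pi^{ITS}_\pm$, $\widetilde m^{Q^{ITS}}(u,\cdot)$ equals, for all $u\in(0,1)$: $(1-p)\,\delta_{F_\nu^{-1}(u)}+p\,\delta_{F_\nu^{-1}(\varphi(u))}$ with $p=\frac{F_\mu^{-1}(u)-F_\nu^{-1}(u)}{F_\nu^{-1}(\varphi(u))-F_\nu^{-1}(u)}$ if $u<u_d$, $\varphi(u)<1$ and $F_\nu^{-1}(\varphi(u))>F_\mu^{-1}(u)>F_\nu^{-1}(u)$;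 $(1-q)\,\delta_{F_\nu^{-1}(u)}+q\,\delta_{F_\nu^{-1}(\widetilde\varphi(u))}$ with $q=\frac{F_\nu^{-1}(u)-F_\mu^{-1}(u)}{F_\nu^{-1}(u)-F_\nu^{-1}(\widetilde\varphi(u))}$ if $\widetilde\varphi(u)<u_d$ and $F_\nu^{-1}(\widetilde\varphi(u))<F_\mu^{-1}(u)<F_\nu^{-1}(u)$; and $\delta_{F_\nu^{-1}(u)}$ otherwise. The associated measure $\mu(dx)\,m^{Q^{ITS}}(x,dy)$ is a supermartingale coupling between $\mu$ and $\nu$ (the inverse transform supermartingale coupling). **Part 2.** Suppose $\mu\le_{icx}\nu$, and let $\bar\mu,\bar\nu$ be the images of $\mu,\nu$ under $x\mapsto-x$. Then $\bar\mu\le_{dcx}\bar\nu$, and for every supermartingale coupling $M$ between $\bar\mu$ and $\bar\nu$ the image of $M$ under $(x,y)\mapsto(-x,-y)$ is a submartingale coupling between $\mu$ and $\nu$. In particular, if the number $u_d$ associated with $(\bar\mu,\bar\nu)$ is positive, this holds for $\bar\mu(dx)\,m^Q(x,dy)$, for every $Q$ in the set $\mathcal Q^d$ associated with $(\bar\mu,\bar\nu)$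 and every choice of the disintegration kernels, and for the inverse transform supermartingale coupling between $\bar\mu$ and $\bar\nu$. -/

import Mathlib

open MeasureTheory ProbabilityTheory Set

noncomputable section

namespace ITCoupling

/-! ### Quantile functions and stochastic orders -/

/-- The quantile function `F_μ⁻¹(u) = inf {x | F_μ(x) ≥ u}`, meaningful for `u ∈ (0,1)`. -/
def quantile (μ : Measure ℝ) (u : ℝ) : ℝ := sInf {x : ℝ | u ≤ cdf μ x}

/-- Decreasing convex order on laws with finite first moment: `∫ f dμ ≤ ∫ f dν` for every
nonincreasing convex `f`. The negative part of a convex `f` is integrable against such laws, so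
both integrals are well defined in `(-∞, +∞]`; the inequality is trivial when the right-hand side
is `+∞`, and otherwise it says that the left-hand side is finite and at most the right-hand side. -/
def DcxLE (μ ν : Measure ℝ) : Prop :=
  ∀ f : ℝ → ℝ, Antitone f → ConvexOn ℝ univ f → Integrable f ν →
    Integrable f μ ∧ ∫ x, f x ∂μ ≤ ∫ x, f x ∂ν

/-- Increasing convex order: `∫ f dμ ≤ ∫ f dν` (in `(-∞, +∞]`) for every nondecreasing
convex `f`. -/
def IcxLE (μ ν : Measure ℝ) : Prop :=
  ∀ f : ℝ → ℝ, Monotone f → ConvexOn ℝ univ f → Integrable f ν →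
    Integrable f μ ∧ ∫ x, f x ∂μ ≤ ∫ x, f x ∂ν

/-! ### Super- and submartingale couplings -/

/-- `M` is a coupling between `μ` and `ν`. -/
structure IsCoupling (M : Measure (ℝ × ℝ)) (μ ν : Measure ℝ) : Prop where
  fst_eq : M.map Prod.fst = μ
  snd_eq : M.map Prod.snd = ν

/-- `M(dx,dy) = μ(dx) m(x,dy)` is a coupling between `μ` and `ν` such that, for `μ`-almost every
`x`, `∫ |y| m(x,dy) < ∞` and `∫ y m(x,dy) ≤ x`. -/
structure IsSupermartingaleCoupling (M : Measure (ℝ × ℝ)) (μ ν : Measure ℝ) : Prop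
    extends IsCoupling M μ ν where
  exists_kernel : ∃ m : Kernel ℝ ℝ, IsMarkovKernel m ∧ M = μ ⊗ₘ m ∧
    ∀ᵐ x ∂μ, Integrable (fun y : ℝ => y) (m x) ∧ ∫ y, y ∂(m x) ≤ x

/-- `M(dx,dy) = μ(dx) m(x,dy)` is a coupling between `μ` and `ν` such that, for `μ`-almost every
`x`, `∫ |y| m(x,dy) < ∞` and `∫ y m(x,dy) ≥ x`. -/
structure IsSubmartingaleCoupling (M : Measure (ℝ × ℝ)) (μ ν : Measure ℝ) : Prop
    extends IsCoupling M μ ν where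
  exists_kernel : ∃ m : Kernel ℝ ℝ, IsMarkovKernel m ∧ M = μ ⊗ₘ m ∧
    ∀ᵐ x ∂μ, Integrable (fun y : ℝ => y) (m x) ∧ x ≤ ∫ y, y ∂(m x)

/-! ### The functions `Ψ₊`, `Ψ₋`, `φ`, `φ̃` and the constants `u_d`, `γ_d` -/

/-- `(F_μ⁻¹ - F_ν⁻¹)⁺`. -/
def gapPos (μ ν : Measure ℝ) (u : ℝ) : ℝ := max (quantile μ u - quantile ν u) 0

/-- `(F_μ⁻¹ - F_ν⁻¹)⁻`. -/
def gapNeg (μ ν : Measure ℝ) (u : ℝ) : ℝ := max (-(quantile μ u - quantile ν u)) 0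

/-- `Ψ₊(u) = ∫₀ᵘ (F_μ⁻¹ - F_ν⁻¹)⁺(v) dv`. -/
def PsiPlus (μ ν : Measure ℝ) (u : ℝ) : ℝ := ∫ v in (0 : ℝ)..u, gapPos μ ν v

/-- `Ψ₋(u) = ∫₀ᵘ (F_μ⁻¹ - F_ν⁻¹)⁻(v) dv`. -/
def PsiMinus (μ ν : Measure ℝ) (u : ℝ) : ℝ := ∫ v in (0 : ℝ)..u, gapNeg μ ν v

/-- `φ = Ψ₋⁻¹ ∘ Ψ₊`, with the left-continuous generalised inverse. It is only used where the set
is non-empty. -/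
def phi (μ ν : Measure ℝ) (u : ℝ) : ℝ :=
  sInf {r : ℝ | r ∈ Icc (0 : ℝ) 1 ∧ PsiPlus μ ν u ≤ PsiMinus μ ν r}

/-- `φ̃ = Ψ₊⁻¹ ∘ Ψ₋`, with the left-continuous generalised inverse. -/
def phiTilde (μ ν : Measure ℝ) (u : ℝ) : ℝ :=
  sInf {r : ℝ | r ∈ Icc (0 : ℝ) 1 ∧ PsiMinus μ ν u ≤ PsiPlus μ ν r}

/-- `u_d = φ̃(1)`. -/
def uD (μ ν : Measure ℝ) : ℝ := phiTilde μ ν 1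

/-- `γ_d = ∫₀^{u_d} (F_μ⁻¹ - F_ν⁻¹)⁺(u) du`. -/
def gammaD (μ ν : Measure ℝ) : ℝ := ∫ u in (0 : ℝ)..uD μ ν, gapPos μ ν u

/-- The measure `γ_d⁻¹ (F_μ⁻¹ - F_ν⁻¹)⁺(u) du` on `(0, u_d)`. -/
def rhoPlus (μ ν : Measure ℝ) : Measure ℝ :=
  (volume.restrict (Ioo 0 (uD μ ν))).withDensity
    fun u => ENNReal.ofReal (1 / gammaD μ ν * gapPos μ ν u)

/-- The measure `γ_d⁻¹ (F_μ⁻¹ - F_ν⁻¹)⁻(v) dv` on `(0, 1)`. -/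
def rhoMinus (μ ν : Measure ℝ) : Measure ℝ :=
  (volume.restrict (Ioo 0 1)).withDensity
    fun v => ENNReal.ofReal (1 / gammaD μ ν * gapNeg μ ν v)

/-! ### The set `𝒬^d` and the kernels -/

/-- Membership in the set `𝒬^d` of probability measures on `(0, u_d) × (0, 1)` (seen as measures
on `ℝ × ℝ` concentrated there). -/
structure IsQd (μ ν : Measure ℝ) (Q : Measure (ℝ × ℝ)) : Prop where
  prob : IsProbabilityMeasure Q
  fst_eq : Q.map Prod.fst = rhoPlus μ ν
  snd_eq : Q.map Prod.snd = rhoMinus μ ν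
  lt_ae : Q {p : ℝ × ℝ | p.1 ∈ Ioo 0 (uD μ ν) ∧ p.2 ∈ Ioo (0 : ℝ) 1 ∧ p.1 < p.2} = 1

/-- The set `𝒬^d`. -/
def Qd (μ ν : Measure ℝ) : Set (Measure (ℝ × ℝ)) := {Q | IsQd μ ν Q}

/-- `πp = π₊` and `πm = π₋` are sub-Markov kernels (with values in the measures on `(0,1)`, resp.
on `(0,u_d)`) such that
`Q(du,dv) = γ_d⁻¹ (F_μ⁻¹ - F_ν⁻¹)⁺(u) du π₊(u,dv) = γ_d⁻¹ (F_μ⁻¹ - F_ν⁻¹)⁻(v) dv π₋(v,du)`. -/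
structure IsDisintegration (μ ν : Measure ℝ) (Q : Measure (ℝ × ℝ)) (πp πm : Kernel ℝ ℝ) :
    Prop where
  plus_le : ∀ u, πp u univ ≤ 1
  plus_supp : ∀ u, πp u (Ioo (0 : ℝ) 1)ᶜ = 0
  minus_le : ∀ v, πm v univ ≤ 1
  minus_supp : ∀ v, πm v (Ioo 0 (uD μ ν))ᶜ = 0
  eq_plus : Q = rhoPlus μ ν ⊗ₘ πp
  eq_minus : Q = (rhoMinus μ ν ⊗ₘ πm).map Prod.swap

/-- The measure
`∫ (F_μ⁻¹(u) - F_ν⁻¹(u)) / (F_ν⁻¹(v) - F_ν⁻¹(u)) δ_{F_ν⁻¹(v)}(dy) κ(dv)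
  + (∫ (F_ν⁻¹(v) - F_μ⁻¹(u)) / (F_ν⁻¹(v) - F_ν⁻¹(u)) κ(dv)) δ_{F_ν⁻¹(u)}(dy)`. -/
def mixture (μ ν : Measure ℝ) (u : ℝ) (κ : Measure ℝ) : Measure ℝ :=
  (κ.withDensity fun v => ENNReal.ofReal
      ((quantile μ u - quantile ν u) / (quantile ν v - quantile ν u))).map (quantile ν)
    + (∫⁻ v, ENNReal.ofReal
        ((quantile ν v - quantile μ u) / (quantile ν v - quantile ν u)) ∂κ)
      • Measure.dirac (quantile ν u)

open Classical in
/-- The kernel `m̃^Q(u, dy)`, `u ∈ (0,1)`, built from `π₊` and `π₋`. -/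
def mTilde (μ ν : Measure ℝ) (πp πm : Kernel ℝ ℝ) (u : ℝ) : Measure ℝ :=
  if quantile ν u < quantile μ u ∧ u ∈ Ioo 0 (uD μ ν) ∧
      πp u {v | v ∈ Ioo (0 : ℝ) 1 ∧ quantile μ u < quantile ν v} = 1 then
    mixture μ ν u (πp u)
  else if quantile μ u < quantile ν u ∧ u ∈ Ioo (0 : ℝ) 1 ∧
      πm u {v | v ∈ Ioo (0 : ℝ) 1 ∧ quantile ν v < quantile μ u} = 1 then
    mixture μ ν u (πm u)
  else Measure.dirac (quantile ν u)

open Classical in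
/-- The kernel `m(x, dy)`, `x ∈ ℝ`, built from a kernel `m̃(u, dy)`, `u ∈ (0,1)`:
`δ_x` if `F_μ(x) = 0` or `F_μ(x₋) = 1`; `μ({x})⁻¹ ∫_{F_μ(x₋)}^{F_μ(x)} m̃(u, dy) du` if
`μ({x}) > 0`; `m̃(F_μ(x), dy)` otherwise. -/
def grandM (μ : Measure ℝ) (mt : ℝ → Measure ℝ) (x : ℝ) : Measure ℝ :=
  if cdf μ x = 0 ∨ Function.leftLim (cdf μ) x = 1 then Measure.dirac x
  else if 0 < μ {x} then
    (μ {x})⁻¹ • (volume.restrict (Ioc (Function.leftLim (cdf μ) x) (cdf μ x))).bind mt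
  else mt (cdf μ x)

/-! ### The inverse transform case -/

/-- `Q^{ITS}(du,dv) = γ_d⁻¹ (F_μ⁻¹ - F_ν⁻¹)⁺(u) du 1_{0 < φ(u) < 1} δ_{φ(u)}(dv)` on
`(0,u_d) × (0,1)`, written as the image of `1_{0 < φ(u) < 1} γ_d⁻¹ (F_μ⁻¹ - F_ν⁻¹)⁺(u) du` by
`u ↦ (u, φ(u))`. -/
def QITS (μ ν : Measure ℝ) : Measure (ℝ × ℝ) :=
  ((rhoPlus μ ν).restrict {u | 0 < phi μ ν u ∧ phi μ ν u < 1}).map fun u => (u, phi μ ν u)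

open Classical in
/-- `π₊^{ITS}(u,dv) = 1_{0 < φ(u) < 1} δ_{φ(u)}(dv)` for `u ∈ (0,u_d)`, extended by zero. -/
def piITSPlus (μ ν : Measure ℝ) (u : ℝ) : Measure ℝ :=
  if u ∈ Ioo 0 (uD μ ν) ∧ 0 < phi μ ν u ∧ phi μ ν u < 1 then Measure.dirac (phi μ ν u) else 0

open Classical in
/-- `π₋^{ITS}(v,du) = 1_{0 < φ̃(v) < u_d} δ_{φ̃(v)}(du)` for `v ∈ (0,1)`, extended by zero. -/
def piITSMinus (μ ν : Measure ℝ) (v : ℝ) : Measure ℝ :=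
  if v ∈ Ioo (0 : ℝ) 1 ∧ 0 < phiTilde μ ν v ∧ phiTilde μ ν v < uD μ ν then
    Measure.dirac (phiTilde μ ν v) else 0

open Classical in
/-- The explicit form of `m̃^{Q^{ITS}}(u, dy)`, `u ∈ (0,1)`. -/
def mTildeITS (μ ν : Measure ℝ) (u : ℝ) : Measure ℝ :=
  if u < uD μ ν ∧ quantile μ u < quantile ν (phi μ ν u) ∧ quantile ν u < quantile μ u ∧
      phi μ ν u < 1 then
    ENNReal.ofReal (1 - (quantile μ u - quantile ν u) / (quantile ν (phi μ ν u) - quantile ν u))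
        • Measure.dirac (quantile ν u)
      + ENNReal.ofReal
          ((quantile μ u - quantile ν u) / (quantile ν (phi μ ν u) - quantile ν u))
        • Measure.dirac (quantile ν (phi μ ν u))
  else if quantile ν (phiTilde μ ν u) < quantile μ u ∧ quantile μ u < quantile ν u ∧
      phiTilde μ ν u < uD μ ν then
    ENNReal.ofReal
          (1 - (quantile ν u - quantile μ u) / (quantile ν u - quantile ν (phiTilde μ ν u)))
        • Measure.dirac (quantile ν u)
      + ENNReal.ofReal
          ((quantile ν u - quantile μ u) / (quantile ν u - quantile ν (phiTilde μ ν u)))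
        • Measure.dirac (quantile ν (phiTilde μ ν u))
  else Measure.dirac (quantile ν u)

/-- The image of a law on `ℝ` by `x ↦ -x`. -/
def reflect (μ : Measure ℝ) : Measure ℝ := μ.map fun x => -x

/-- The image of a law on `ℝ × ℝ` by `(x, y) ↦ (-x, -y)`. -/
def reflect₂ (M : Measure (ℝ × ℝ)) : Measure (ℝ × ℝ) := M.map fun p => (-p.1, -p.2)

end ITCoupling

end

open ITCoupling

/-!
Only the levels `u ∈ (0, 1)` at which `F_μ⁻¹(u) ≠ F_ν⁻¹(u)` have to be corrected. Along `Q`, a level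
`u` with `F_μ⁻¹(u) > F_ν⁻¹(u)` sends mass from `F_ν⁻¹(u)` up to `F_ν⁻¹(v)`, and `v` sends mass from
`F_ν⁻¹(v)` down to `F_ν⁻¹(u)`, both at the rate `γ_d Q(du, dv) / (F_ν⁻¹(v) - F_ν⁻¹(u))`. The two
flows cancel, so the average of `m̃^Q(u, ·)` over `u` stays `ν`, while each exchanging level gets
barycentre `F_μ⁻¹(u)`. Testing `μ ≤_dcx ν` on put payoffs gives `Ψ₋ ≤ Ψ₊`, hence every level with
`F_μ⁻¹(u) < F_ν⁻¹(u)` does exchange mass, and at the levels that do not the barycentre `F_ν⁻¹(u)` is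
at most `F_μ⁻¹(u)`. Pushing Lebesgue measure on `(0, 1)` forward by `F_μ⁻¹` gives the
supermartingale coupling of `μ` and `ν`.

The functions `Ψ₊` and `Ψ₋` push the densities `(F_μ⁻¹ - F_ν⁻¹)^±` to Lebesgue measure on
`(0, γ_d)`, so `φ`, a left-continuous inverse of `Ψ₋` composed with `Ψ₊`, transports one marginal of
`𝒬^d` to the other. The increasing order reduces to the decreasing one by `x ↦ -x`.
-/

noncomputable section

namespace ITCoupling

open Filter Topology

/-! ### Quantile functions -/

section Quantile

variable {μ ν : Measure ℝ} {u x : ℝ}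

lemma quantile_le_iff (hu : u ∈ Ioo (0 : ℝ) 1) : quantile μ u ≤ x ↔ u ≤ cdf μ x := by
  have hbdd : BddBelow {x : ℝ | u ≤ cdf μ x} := by
    obtain ⟨y, hy⟩ := ((tendsto_cdf_atBot μ).eventually (gt_mem_nhds hu.1)).exists
    exact ⟨y, fun z hz => le_of_not_gt fun hzy =>
      (hz.trans (monotone_cdf μ hzy.le)).not_gt hy⟩
  have hne : {x : ℝ | u ≤ cdf μ x}.Nonempty := by
    obtain ⟨y, hy⟩ := ((tendsto_cdf_atTop μ).eventually (lt_mem_nhds hu.2)).exists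
    exact ⟨y, hy.le⟩
  refine ⟨fun h => ?_, fun h => csInf_le hbdd h⟩
  have hlim : Tendsto (cdf μ) (𝓝[>] x) (𝓝 (cdf μ x)) :=
    ((cdf μ).right_continuous x).mono_left (nhdsWithin_mono _ Ioi_subset_Ici_self)
  refine ge_of_tendsto hlim ?_
  filter_upwards [self_mem_nhdsWithin] with y hy
  obtain ⟨z, hz, hzy⟩ := exists_lt_of_csInf_lt hne (lt_of_le_of_lt h hy)
  exact le_trans hz (monotone_cdf μ hzy.le)

lemma lt_quantile_iff (hu : u ∈ Ioo (0 : ℝ) 1) : x < quantile μ u ↔ cdf μ x < u := by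
  rw [← not_le, quantile_le_iff hu, not_le]

lemma monotoneOn_quantile : MonotoneOn (quantile μ) (Ioo 0 1) := fun _ hu _ hv huv =>
  (quantile_le_iff hu).2 (huv.trans ((quantile_le_iff hv).1 le_rfl))

lemma quantile_of_notMem_Ioo (hu : u ∉ Ioo (0 : ℝ) 1) (hu1 : u ≠ 1) : quantile μ u = 0 := by
  rcases le_or_gt u 0 with h | h
  · have : {x : ℝ | u ≤ cdf μ x} = univ := eq_univ_of_forall fun x => h.trans (cdf_nonneg μ x)
    simp [quantile, this]
  · have : {x : ℝ | u ≤ cdf μ x} = ∅ := eq_empty_of_forall_notMem fun x hx =>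
      hu ⟨h, (hx.trans (cdf_le_one μ x)).lt_of_ne hu1⟩
    simp [quantile, this]

lemma measurable_indicator_of_monotoneOn {α β : Type*} [TopologicalSpace α] [MeasurableSpace α]
    [BorelSpace α] [LinearOrder α] [OrderClosedTopology α] [TopologicalSpace β]
    [MeasurableSpace β] [BorelSpace β] [LinearOrder β] [OrderTopology β]
    [SecondCountableTopology β] [Zero β] {s : Set α} {f : α → β} (hs : MeasurableSet s)
    (hf : MonotoneOn f s) : Measurable (s.indicator f) := by
  have hmono : Monotone (s.domRestrict f) := fun a b hab => hf a.2 b.2 hab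
  refine measurable_of_restrict_of_restrict_compl hs ?_ ?_
  · convert hmono.measurable using 1
    exact funext fun a => indicator_of_mem a.2 f
  · convert measurable_const (a := (0 : β)) using 1
    exact funext fun a => indicator_of_notMem a.2 f

lemma measurable_quantile (μ : Measure ℝ) : Measurable (quantile μ) := by
  have hind : Measurable ((Ioo 0 1).indicator (quantile μ)) :=
    measurable_indicator_of_monotoneOn measurableSet_Ioo monotoneOn_quantile
  refine hind.measurable_of_countable_ne
    ((countable_singleton (1 : ℝ)).mono fun u hu => by_contra fun hu1 => hu ?_)
  by_cases hmem : u ∈ Ioo (0 : ℝ) 1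
  · rw [indicator_of_mem hmem]
  · rw [indicator_of_notMem hmem, quantile_of_notMem_Ioo hmem hu1]

instance isProbabilityMeasure_volume_Ioo :
    IsProbabilityMeasure ((volume : Measure ℝ).restrict (Ioo 0 1)) :=
  ⟨by simp⟩

lemma map_quantile (μ : Measure ℝ) [IsProbabilityMeasure μ] :
    (volume.restrict (Ioo (0 : ℝ) 1)).map (quantile μ) = μ := by
  have hmeas := measurable_quantile μ
  have : IsProbabilityMeasure ((volume.restrict (Ioo (0 : ℝ) 1)).map (quantile μ)) :=
    Measure.isProbabilityMeasure_map hmeas.aemeasurable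
  refine Measure.ext_of_Iic _ _ fun x => ?_
  have hpre : quantile μ ⁻¹' Iic x ∩ Ioo 0 1 = Ioo 0 1 ∩ Iic (cdf μ x) := by
    rw [inter_comm]
    exact Set.ext fun u => and_congr_right fun hu => quantile_le_iff hu
  have hIoc : (Ioo 0 1 ∩ Iic (cdf μ x) : Set ℝ) =ᵐ[volume] Ioc 0 (cdf μ x) := by
    have h : Ioc 0 (cdf μ x) = Ioc 0 1 ∩ Iic (cdf μ x) := by
      rw [Ioc_inter_Iic, min_eq_right (cdf_le_one μ x)]
    rw [h]
    exact Ioo_ae_eq_Ioc.inter (ae_eq_refl _)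
  rw [Measure.map_apply hmeas measurableSet_Iic, Measure.restrict_apply (hmeas measurableSet_Iic),
    hpre, measure_congr hIoc, Real.volume_Ioc, sub_zero, ofReal_cdf]

lemma integrable_quantile [IsProbabilityMeasure μ] (hμ : Integrable (fun x : ℝ => x) μ) :
    Integrable (quantile μ) (volume.restrict (Ioo 0 1)) := by
  rw [← map_quantile μ] at hμ
  exact (integrable_map_measure aestronglyMeasurable_id
    (measurable_quantile μ).aemeasurable).1 hμ

lemma integral_comp_quantile [IsProbabilityMeasure μ] {f : ℝ → ℝ} (hf : Measurable f) :
    ∫ u in Ioo (0 : ℝ) 1, f (quantile μ u) = ∫ x, f x ∂μ := by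
  conv_rhs => rw [← map_quantile μ]
  rw [integral_map (measurable_quantile μ).aemeasurable hf.aestronglyMeasurable]

lemma Ioc_subset_Ioo_zero_one (hu : u < 1) : Ioc 0 u ⊆ Ioo (0 : ℝ) 1 :=
  fun _ hv => ⟨hv.1, hv.2.trans_lt hu⟩

lemma integrableOn_quantile [IsProbabilityMeasure μ] (hμ : Integrable (fun x : ℝ => x) μ)
    (hu : u < 1) : IntegrableOn (quantile μ) (Ioc 0 u) :=
  IntegrableOn.mono_set (integrable_quantile hμ) (Ioc_subset_Ioo_zero_one hu)

/-! ### Put payoffs and the decreasing convex order -/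

lemma DcxLE.integral_put_le [IsFiniteMeasure ν] (hν : Integrable (fun x : ℝ => x) ν)
    (h : DcxLE μ ν) (K : ℝ) : ∫ x, max (K - x) 0 ∂μ ≤ ∫ x, max (K - x) 0 ∂ν := by
  refine (h _ (fun x y hxy => max_le_max (by linarith) le_rfl) ?_ ?_).2
  · exact ((convexOn_const K convex_univ).sub (concaveOn_id convex_univ)).sup
      (convexOn_const 0 convex_univ)
  · exact ((integrable_const K).sub hν).pos_part

lemma setIntegral_sub_quantile_le_integral_put [IsProbabilityMeasure μ]
    (hμ : Integrable (fun x : ℝ => x) μ) (K : ℝ) (hu : u < 1) :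
    ∫ v in Ioc 0 u, (K - quantile μ v) ≤ ∫ x, max (K - x) 0 ∂μ := by
  have hput : IntegrableOn (fun v => max (K - quantile μ v) 0) (Ioo 0 1) :=
    ((integrable_const K).sub (integrable_quantile hμ)).pos_part
  have hsub := Ioc_subset_Ioo_zero_one hu
  calc ∫ v in Ioc 0 u, (K - quantile μ v)
      ≤ ∫ v in Ioc 0 u, max (K - quantile μ v) 0 :=
        setIntegral_mono ((integrable_const K).sub (integrableOn_quantile hμ hu))
          (hput.mono_set hsub) fun _ => le_max_left _ _
    _ ≤ ∫ v in Ioo 0 1, max (K - quantile μ v) 0 :=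
        setIntegral_mono_set hput (ae_of_all _ fun _ => le_max_right _ _) hsub.eventuallyLE
    _ = ∫ x, max (K - x) 0 ∂μ :=
        integral_comp_quantile (f := fun x => max (K - x) 0) (by fun_prop)

lemma integral_put_quantile [IsProbabilityMeasure μ] (hu : u ∈ Ioo (0 : ℝ) 1) :
    ∫ x, max (quantile μ u - x) 0 ∂μ = ∫ v in Ioc 0 u, (quantile μ u - quantile μ v) := by
  rw [← integral_comp_quantile (f := fun x => max (quantile μ u - x) 0) (by fun_prop),
    setIntegral_eq_of_subset_of_forall_sdiff_eq_zero measurableSet_Ioo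
      (Ioc_subset_Ioo_zero_one hu.2)]
  · exact setIntegral_congr_fun measurableSet_Ioc fun v hv => max_eq_left
      (sub_nonneg.2 (monotoneOn_quantile (Ioc_subset_Ioo_zero_one hu.2 hv) hu hv.2))
  · exact fun v hv => max_eq_right (sub_nonpos.2 (monotoneOn_quantile hu hv.1
      (le_of_not_ge fun hvu => hv.2 ⟨hv.1.1, hvu⟩)))

lemma DcxLE.setIntegral_quantile_le [IsProbabilityMeasure μ] [IsProbabilityMeasure ν]
    (hμ : Integrable (fun x : ℝ => x) μ) (hν : Integrable (fun x : ℝ => x) ν)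
    (h : DcxLE μ ν) (hu : u ∈ Ioo (0 : ℝ) 1) :
    ∫ v in Ioc 0 u, quantile ν v ≤ ∫ v in Ioc 0 u, quantile μ v := by
  have hput := (setIntegral_sub_quantile_le_integral_put hμ (quantile ν u) hu.2).trans
    (h.integral_put_le hν (quantile ν u))
  rw [integral_put_quantile hu,
    integral_sub (integrable_const _) (integrableOn_quantile hμ hu.2),
    integral_sub (integrable_const _) (integrableOn_quantile hν hu.2)] at hput
  linarith

end Quantile

/-! ### Left-continuous inverses of primitives of densities -/

/-- The left-continuous generalised inverse, with values in `[0,1]`, of a nondecreasing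
function; `0` where no `r ∈ [0,1]` has `t ≤ Φ r`. Both `φ` and `φ̃` are of this form. -/
def leftInv (Φ : ℝ → ℝ) (t : ℝ) : ℝ := sInf {r : ℝ | r ∈ Icc (0 : ℝ) 1 ∧ t ≤ Φ r}

section LeftInv

variable {Φ : ℝ → ℝ} {t c : ℝ}

lemma leftInv_mem (hΦ : Continuous Φ) (ht : t ≤ Φ 1) :
    leftInv Φ t ∈ Icc (0 : ℝ) 1 ∧ t ≤ Φ (leftInv Φ t) :=
  (isClosed_Icc.inter (isClosed_le continuous_const hΦ)).csInf_mem
    ⟨1, ⟨zero_le_one, le_rfl⟩, ht⟩ ⟨0, fun _ hr => hr.1.1⟩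

lemma leftInv_le (hc : c ∈ Icc (0 : ℝ) 1) (h : t ≤ Φ c) : leftInv Φ t ≤ c :=
  csInf_le ⟨0, fun _ hr => hr.1.1⟩ ⟨hc, h⟩

lemma leftInv_le_iff (hΦ : Continuous Φ) (hm : Monotone Φ) (ht : t ≤ Φ 1)
    (hc : c ∈ Icc (0 : ℝ) 1) : leftInv Φ t ≤ c ↔ t ≤ Φ c :=
  ⟨fun h => (leftInv_mem hΦ ht).2.trans (hm h), leftInv_le hc⟩

lemma apply_leftInv (hΦ : Continuous Φ) (h0 : Φ 0 ≤ t) (ht : t ≤ Φ 1) : Φ (leftInv Φ t) = t := by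
  obtain ⟨hmem, hle⟩ := leftInv_mem hΦ ht
  obtain ⟨r, hr, hrt⟩ := intermediate_value_Icc hmem.1 hΦ.continuousOn ⟨h0, hle⟩
  rwa [← (leftInv_le ⟨hr.1, hr.2.trans hmem.2⟩ hrt.ge).antisymm hr.2] at hrt

lemma measurable_leftInv (hΦ : Continuous Φ) (hm : Monotone Φ) : Measurable (leftInv Φ) := by
  have hind : leftInv Φ = (Iic (Φ 1)).indicator (leftInv Φ) := by
    refine (indicator_eq_self.2 fun t ht => ?_).symm
    by_contra hlt
    rw [mem_Iic, not_le] at hlt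
    have hempty : {r : ℝ | r ∈ Icc (0 : ℝ) 1 ∧ t ≤ Φ r} = ∅ :=
      eq_empty_of_forall_notMem fun r hr => (hr.2.trans (hm hr.1.2)).not_gt hlt
    exact ht (by rw [leftInv, hempty, Real.sInf_empty])
  rw [hind]
  refine measurable_indicator_of_monotoneOn measurableSet_Iic fun s _ t ht hst => ?_
  obtain ⟨hmem, hle⟩ := leftInv_mem hΦ ht
  exact leftInv_le hmem (hst.trans hle)

end LeftInv

/-- The measure `g(u) du` on `(0, e)`; `rhoPlus` and `rhoMinus` are of this form. -/
def densityOn (g : ℝ → ℝ) (e : ℝ) : Measure ℝ :=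
  (volume.restrict (Ioo 0 e)).withDensity fun u => ENNReal.ofReal (g u)

section Primitive

variable {g : ℝ → ℝ} {e s : ℝ}

lemma ae_densityOn_iff {p : ℝ → Prop} (hg : Measurable g) :
    (∀ᵐ u ∂(densityOn g e), p u) ↔ ∀ᵐ u, u ∈ Ioo 0 e → 0 < g u → p u := by
  rw [densityOn, ae_withDensity_iff hg.ennreal_ofReal, ae_restrict_iff' measurableSet_Ioo]
  simp only [ne_eq, ENNReal.ofReal_eq_zero, not_le]

lemma ae_densityOn_mem : ∀ᵐ u ∂(densityOn g e), u ∈ Ioo 0 e :=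
  (withDensity_absolutelyContinuous _ _).ae_le (ae_restrict_mem measurableSet_Ioo)

lemma densityOn_const_mul {c : ℝ} (hc : 0 ≤ c) (g : ℝ → ℝ) (e : ℝ) :
    densityOn (fun u => c * g u) e = ENNReal.ofReal c • densityOn g e := by
  rw [densityOn, densityOn, ← withDensity_smul' _ _ ENNReal.ofReal_ne_top]
  simp only [ENNReal.ofReal_mul hc]
  rfl

lemma isFiniteMeasure_densityOn (hg : Integrable g) : IsFiniteMeasure (densityOn g e) :=
  isFiniteMeasure_withDensity_ofReal hg.integrableOn.2

lemma monotone_primitive (hg : Integrable g) (hg0 : 0 ≤ g) :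
    Monotone fun u => ∫ v in (0 : ℝ)..u, g v := by
  intro x y hxy
  have hsub := intervalIntegral.integral_interval_sub_left (a := 0) (b := y) (c := x)
    hg.intervalIntegrable hg.intervalIntegrable
  exact sub_nonneg.1 (hsub ▸ intervalIntegral.integral_nonneg hxy fun u _ => hg0 u)

lemma continuous_primitive (hg : Integrable g) : Continuous fun u => ∫ v in (0 : ℝ)..u, g v :=
  intervalIntegral.continuous_primitive (fun _ _ => hg.intervalIntegrable) 0

lemma Ici_inter_Ioo_ae_eq (s e : ℝ) : (Ici s ∩ Ioo 0 e : Set ℝ) =ᵐ[volume] Ioc (max 0 s) e := by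
  rw [inter_comm, ← Ioc_inter_Ioi]
  exact Ioo_ae_eq_Ioc.inter Ioi_ae_eq_Ici.symm

lemma volume_restrict_Ioo_Ici (s e : ℝ) :
    volume.restrict (Ioo 0 e) (Ici s) = ENNReal.ofReal (e - max 0 s) := by
  rw [Measure.restrict_apply measurableSet_Ici, measure_congr (Ici_inter_Ioo_ae_eq s e),
    Real.volume_Ioc]

lemma densityOn_Ici (hg : Integrable g) (hg0 : 0 ≤ g) (hs : 0 ≤ s) (hse : s ≤ e) :
    densityOn g e (Ici s)
      = ENNReal.ofReal ((∫ v in (0 : ℝ)..e, g v) - ∫ v in (0 : ℝ)..s, g v) := by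
  rw [densityOn, withDensity_apply _ measurableSet_Ici, Measure.restrict_restrict measurableSet_Ici,
    Measure.restrict_congr_set (Ici_inter_Ioo_ae_eq s e), max_eq_right hs,
    intervalIntegral.integral_interval_sub_left hg.intervalIntegrable hg.intervalIntegrable,
    intervalIntegral.integral_of_le hse,
    ofReal_integral_eq_lintegral_ofReal hg.integrableOn (ae_of_all _ hg0)]

lemma densityOn_univ (hg : Integrable g) (hg0 : 0 ≤ g) (he : 0 ≤ e) :
    densityOn g e univ = ENNReal.ofReal (∫ v in (0 : ℝ)..e, g v) := by
  have hIci : (Ici 0 : Set ℝ) =ᵐ[densityOn g e] univ :=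
    eventuallyEq_univ.2 (ae_densityOn_mem.mono fun u hu => hu.1.le)
  rw [← measure_congr hIci, densityOn_Ici hg hg0 le_rfl he, intervalIntegral.integral_same,
    sub_zero]

lemma densityOn_preimage_primitive_Ici (hg : Integrable g) (hg0 : 0 ≤ g) (he : e ∈ Icc (0 : ℝ) 1)
    (t : ℝ) :
    densityOn g e ((fun u => ∫ v in (0 : ℝ)..u, g v) ⁻¹' Ici t)
      = ENNReal.ofReal ((∫ v in (0 : ℝ)..e, g v) - max 0 t) := by
  set Φ : ℝ → ℝ := fun u => ∫ v in (0 : ℝ)..u, g v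
  have hc : Continuous Φ := continuous_primitive hg
  have hm : Monotone Φ := monotone_primitive hg hg0
  have h0 : Φ 0 = 0 := intervalIntegral.integral_same
  rcases lt_or_ge (Φ e) t with het | hte
  · have hnull : densityOn g e (Φ ⁻¹' Ici t) = 0 := measure_eq_zero_iff_ae_notMem.2
      (ae_densityOn_mem.mono fun u hu htu => (htu.trans (hm hu.2.le)).not_gt het)
    rw [hnull, ENNReal.ofReal_of_nonpos (sub_nonpos.2 (het.le.trans (le_max_right _ _)))]
  · have hte' : max 0 t ≤ Φ e := max_le (h0.symm.le.trans (hm he.1)) hte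
    have ht1 : max 0 t ≤ Φ 1 := hte'.trans (hm he.2)
    have hpre : Φ ⁻¹' Ici t =ᵐ[densityOn g e] Ici (leftInv Φ (max 0 t)) := by
      filter_upwards [ae_densityOn_mem] with u hu
      have hu0 : 0 ≤ Φ u := h0.symm.le.trans (hm hu.1.le)
      refine propext (Iff.trans ?_
        (leftInv_le_iff hc hm ht1 ⟨hu.1.le, hu.2.le.trans he.2⟩).symm)
      exact ⟨fun htu => max_le hu0 htu, (le_max_right _ _).trans⟩
    rw [measure_congr hpre, densityOn_Ici hg hg0 (leftInv_mem hc ht1).1.1 (leftInv_le he hte')]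
    exact congrArg (fun r => ENNReal.ofReal (Φ e - r))
      (apply_leftInv hc (h0.trans_le (le_max_left _ _)) ht1)

lemma map_primitive_densityOn (hg : Integrable g) (hg0 : 0 ≤ g) (he : e ∈ Icc (0 : ℝ) 1) :
    (densityOn g e).map (fun u => ∫ v in (0 : ℝ)..u, g v)
      = volume.restrict (Ioo 0 (∫ v in (0 : ℝ)..e, g v)) := by
  have := isFiniteMeasure_densityOn (e := e) hg
  refine Measure.ext_of_Ici _ _ fun t => ?_
  rw [Measure.map_apply (continuous_primitive hg).measurable measurableSet_Ici,
    densityOn_preimage_primitive_Ici hg hg0 he, volume_restrict_Ioo_Ici]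

lemma ae_leftInv_primitive (hg : Integrable g) (hg0 : 0 ≤ g) (he : e ∈ Icc (0 : ℝ) 1) :
    ∀ᵐ u ∂(densityOn g e),
      leftInv (fun u => ∫ v in (0 : ℝ)..u, g v) (∫ v in (0 : ℝ)..u, g v) = u := by
  set Φ : ℝ → ℝ := fun u => ∫ v in (0 : ℝ)..u, g v
  have hc : Continuous Φ := continuous_primitive hg
  have hm : Monotone Φ := monotone_primitive hg hg0
  -- A flat piece of `Φ` to the left of `u` contains a rational `q`, and each level `Φ q` is null.
  have hne : ∀ᵐ u ∂(densityOn g e), ∀ q : ℚ, Φ u ≠ Φ q := by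
    refine ae_all_iff.2 fun q => ?_
    have hlevel : ∀ᵐ t ∂((densityOn g e).map Φ), t ≠ Φ q := by
      rw [map_primitive_densityOn hg hg0 he]
      exact Measure.ae_ne _ _
    exact ae_of_ae_map hc.measurable.aemeasurable hlevel
  filter_upwards [hne, ae_densityOn_mem] with u hu hmem
  have hu01 : u ∈ Icc (0 : ℝ) 1 := ⟨hmem.1.le, hmem.2.le.trans he.2⟩
  refine (leftInv_le hu01 le_rfl).antisymm (not_lt.1 fun hlt => ?_)
  obtain ⟨q, hq1, hq2⟩ := exists_rat_btwn hlt
  exact hu q (le_antisymm ((leftInv_mem hc (hm hu01.2)).2.trans (hm hq1.le)) (hm hq2.le))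

end Primitive

/-! ### The functions `Ψ₊`, `Ψ₋`, `φ`, `φ̃` -/

section Psi

variable {μ ν : Measure ℝ} {u : ℝ}

lemma gapNeg_eq_swap (μ ν : Measure ℝ) : gapNeg μ ν = gapPos ν μ := by
  ext u
  simp [gapNeg, gapPos]

lemma PsiMinus_eq_swap (μ ν : Measure ℝ) : PsiMinus μ ν = PsiPlus ν μ := by
  ext u
  simp [PsiMinus, PsiPlus, gapNeg_eq_swap]

lemma gapPos_nonneg (μ ν : Measure ℝ) : 0 ≤ gapPos μ ν := fun _ => le_max_right _ _

lemma gapPos_pos_iff : 0 < gapPos μ ν u ↔ quantile ν u < quantile μ u := by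
  simp [gapPos]

lemma gapPos_sub_gapPos_swap (μ ν : Measure ℝ) (u : ℝ) :
    gapPos μ ν u - gapPos ν μ u = quantile μ u - quantile ν u := by
  simp only [gapPos]
  rcases le_total (quantile μ u) (quantile ν u) with h | h
  · rw [max_eq_right (by linarith), max_eq_left (by linarith)]; ring
  · rw [max_eq_left (by linarith), max_eq_right (by linarith)]; ring

lemma measurable_gapPos (μ ν : Measure ℝ) : Measurable (gapPos μ ν) :=
  ((measurable_quantile μ).sub (measurable_quantile ν)).max measurable_const

lemma PsiPlus_zero (μ ν : Measure ℝ) : PsiPlus μ ν 0 = 0 := intervalIntegral.integral_same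

lemma continuous_PsiPlus (hi : Integrable (gapPos μ ν)) : Continuous (PsiPlus μ ν) :=
  continuous_primitive hi

lemma monotone_PsiPlus (hi : Integrable (gapPos μ ν)) : Monotone (PsiPlus μ ν) :=
  monotone_primitive hi (gapPos_nonneg μ ν)

lemma PsiPlus_nonneg (hi : Integrable (gapPos μ ν)) (hu : 0 ≤ u) : 0 ≤ PsiPlus μ ν u :=
  (PsiPlus_zero μ ν).symm.le.trans (monotone_PsiPlus hi hu)

lemma integrable_gapPos [IsProbabilityMeasure μ] [IsProbabilityMeasure ν]
    (hμ : Integrable (fun x : ℝ => x) μ) (hν : Integrable (fun x : ℝ => x) ν) :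
    Integrable (gapPos μ ν) := by
  have hon : IntegrableOn (gapPos μ ν) (Ioo 0 1) :=
    ((integrable_quantile hμ).sub (integrable_quantile hν)).pos_part
  refine (hon.integrable_indicator measurableSet_Ioo).congr ?_
  filter_upwards [Measure.ae_ne volume (1 : ℝ)] with u hu
  by_cases hmem : u ∈ Ioo (0 : ℝ) 1
  · rw [indicator_of_mem hmem]
  · simp [indicator_of_notMem hmem, gapPos, quantile_of_notMem_Ioo hmem hu]

lemma exists_forall_Ioc_quantile_lt (hu : u ∈ Ioo (0 : ℝ) 1) (h : quantile ν u < quantile μ u) :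
    ∃ s ∈ Ioo 0 u, ∀ v ∈ Ioc s u, quantile ν v < quantile μ v := by
  obtain ⟨c, hc1, hc2⟩ := exists_between h
  have hc := (lt_quantile_iff hu).1 hc2
  refine ⟨max (cdf μ c) (u / 2), ⟨lt_max_of_lt_right (half_pos hu.1),
    max_lt hc (half_lt_self hu.1)⟩, fun v hv => ?_⟩
  have hv0 : 0 < v := (half_pos hu.1).trans ((le_max_right _ _).trans_lt hv.1)
  have hv1 : v ∈ Ioo (0 : ℝ) 1 := ⟨hv0, hv.2.trans_lt hu.2⟩
  exact ((monotoneOn_quantile hv1 hu hv.2).trans_lt hc1).trans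
    ((lt_quantile_iff hv1).2 ((le_max_left _ _).trans_lt hv.1))

lemma exists_PsiPlus_lt (hi : Integrable (gapPos μ ν)) (hu : u ∈ Ioo (0 : ℝ) 1)
    (h : quantile ν u < quantile μ u) :
    ∃ s ∈ Ioo 0 u, PsiPlus μ ν s < PsiPlus μ ν u ∧ ∀ v ∈ Ioc s u, gapPos ν μ v = 0 := by
  obtain ⟨s, hs, hsv⟩ := exists_forall_Ioc_quantile_lt hu h
  refine ⟨s, hs, ?_, fun v hv => max_eq_right (sub_nonpos.2 (hsv v hv).le)⟩
  have hsub := intervalIntegral.integral_interval_sub_left (a := 0) (b := u) (c := s)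
    hi.intervalIntegrable hi.intervalIntegrable
  exact sub_pos.1 (hsub ▸ intervalIntegral.intervalIntegral_pos_of_pos_on hi.intervalIntegrable
    (fun v hv => gapPos_pos_iff.2 (hsv v (Ioo_subset_Ioc_self hv))) hs.2)

lemma phi_eq_leftInv (μ ν : Measure ℝ) : phi μ ν = leftInv (PsiPlus ν μ) ∘ PsiPlus μ ν := by
  ext u
  rw [phi, PsiMinus_eq_swap, Function.comp_apply, leftInv]

lemma phiTilde_eq_leftInv (μ ν : Measure ℝ) :
    phiTilde μ ν = leftInv (PsiPlus μ ν) ∘ PsiPlus ν μ := by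
  ext u
  rw [phiTilde, PsiMinus_eq_swap, Function.comp_apply, leftInv]

lemma uD_eq_leftInv (μ ν : Measure ℝ) : uD μ ν = leftInv (PsiPlus μ ν) (PsiPlus ν μ 1) :=
  congrFun (phiTilde_eq_leftInv μ ν) 1

lemma measurable_phi (hi : Integrable (gapPos μ ν)) (hi' : Integrable (gapPos ν μ)) :
    Measurable (phi μ ν) := by
  rw [phi_eq_leftInv]
  exact (measurable_leftInv (continuous_PsiPlus hi') (monotone_PsiPlus hi')).comp
    (continuous_PsiPlus hi).measurable

lemma measurable_phiTilde (hi : Integrable (gapPos μ ν)) (hi' : Integrable (gapPos ν μ)) :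
    Measurable (phiTilde μ ν) := by
  rw [phiTilde_eq_leftInv]
  exact (measurable_leftInv (continuous_PsiPlus hi) (monotone_PsiPlus hi)).comp
    (continuous_PsiPlus hi').measurable

end Psi

section Carrier

variable {μ ν : Measure ℝ} {p : ℝ → Prop}

/-- The points `u ∈ (0, u_d)` with `F_μ⁻¹(u) > F_ν⁻¹(u)`, which carry `rhoPlus μ ν`. -/
def carrierPlus (μ ν : Measure ℝ) : Set ℝ :=
  {u | u ∈ Ioo 0 (uD μ ν) ∧ quantile ν u < quantile μ u}

/-- The points `v ∈ (0, 1)` with `F_μ⁻¹(v) < F_ν⁻¹(v)`, which carry `rhoMinus μ ν`. -/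
def carrierMinus (μ ν : Measure ℝ) : Set ℝ :=
  {v | v ∈ Ioo (0 : ℝ) 1 ∧ quantile μ v < quantile ν v}

lemma measurableSet_carrierPlus (μ ν : Measure ℝ) : MeasurableSet (carrierPlus μ ν) :=
  measurableSet_Ioo.inter (measurableSet_lt (measurable_quantile ν) (measurable_quantile μ))

lemma measurableSet_carrierMinus (μ ν : Measure ℝ) : MeasurableSet (carrierMinus μ ν) :=
  measurableSet_Ioo.inter (measurableSet_lt (measurable_quantile μ) (measurable_quantile ν))

lemma disjoint_carriers (μ ν : Measure ℝ) : Disjoint (carrierPlus μ ν) (carrierMinus μ ν) :=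
  disjoint_left.2 fun _ hp hm => hp.2.not_gt hm.2

lemma rhoPlus_eq_densityOn (μ ν : Measure ℝ) :
    rhoPlus μ ν = densityOn (fun u => 1 / gammaD μ ν * gapPos μ ν u) (uD μ ν) := rfl

lemma rhoMinus_eq_densityOn (μ ν : Measure ℝ) :
    rhoMinus μ ν = densityOn (fun v => 1 / gammaD μ ν * gapPos ν μ v) 1 := by
  rw [← gapNeg_eq_swap]
  rfl

lemma ae_rhoPlus_mem_carrierPlus (μ ν : Measure ℝ) :
    ∀ᵐ u ∂(rhoPlus μ ν), u ∈ carrierPlus μ ν := by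
  rw [rhoPlus_eq_densityOn, ae_densityOn_iff ((measurable_gapPos μ ν).const_mul _)]
  exact ae_of_all _ fun u hu hg => ⟨hu, gapPos_pos_iff.1
    ((gapPos_nonneg μ ν u).lt_of_ne fun h0 => by simp [← h0] at hg)⟩

lemma ae_rhoMinus_mem_carrierMinus (μ ν : Measure ℝ) :
    ∀ᵐ v ∂(rhoMinus μ ν), v ∈ carrierMinus μ ν := by
  rw [rhoMinus_eq_densityOn, ae_densityOn_iff ((measurable_gapPos ν μ).const_mul _)]
  exact ae_of_all _ fun u hu hg => ⟨hu, gapPos_pos_iff.1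
    ((gapPos_nonneg ν μ u).lt_of_ne fun h0 => by simp [← h0] at hg)⟩

lemma ae_rhoPlus_iff (hγ : 0 < gammaD μ ν) :
    (∀ᵐ u ∂(rhoPlus μ ν), p u) ↔ ∀ᵐ u, u ∈ carrierPlus μ ν → p u := by
  rw [rhoPlus_eq_densityOn, ae_densityOn_iff ((measurable_gapPos μ ν).const_mul _)]
  simp only [mul_pos_iff_of_pos_left (one_div_pos.2 hγ), gapPos_pos_iff, ← and_imp]
  rfl

lemma ae_rhoMinus_iff (hγ : 0 < gammaD μ ν) :
    (∀ᵐ v ∂(rhoMinus μ ν), p v) ↔ ∀ᵐ v, v ∈ carrierMinus μ ν → p v := by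
  rw [rhoMinus_eq_densityOn, ae_densityOn_iff ((measurable_gapPos ν μ).const_mul _)]
  simp only [mul_pos_iff_of_pos_left (one_div_pos.2 hγ), gapPos_pos_iff, ← and_imp]
  rfl

end Carrier

/-- The consequence `Ψ₋ ≤ Ψ₊` on `[0,1]` of the decreasing convex order, with the integrability
that makes both functions meaningful. The negative gap is written as the positive gap of the
swapped pair, so that `Ψ₋ = PsiPlus ν μ`. -/
structure GapDominated (μ ν : Measure ℝ) : Prop where
  integrable : Integrable (gapPos μ ν)
  integrable_swap : Integrable (gapPos ν μ)
  PsiPlus_swap_le : ∀ u ∈ Icc (0 : ℝ) 1, PsiPlus ν μ u ≤ PsiPlus μ ν u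

lemma DcxLE.PsiPlus_swap_le {μ ν : Measure ℝ} [IsProbabilityMeasure μ] [IsProbabilityMeasure ν]
    {u : ℝ} (hμ : Integrable (fun x : ℝ => x) μ) (hν : Integrable (fun x : ℝ => x) ν)
    (h : DcxLE μ ν) (hu : u ∈ Ioo (0 : ℝ) 1) : PsiPlus ν μ u ≤ PsiPlus μ ν u := by
  have hsub : PsiPlus μ ν u - PsiPlus ν μ u
      = (∫ v in Ioc 0 u, quantile μ v) - ∫ v in Ioc 0 u, quantile ν v := by
    rw [← integral_sub (integrableOn_quantile hμ hu.2) (integrableOn_quantile hν hu.2)]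
    simp only [PsiPlus, intervalIntegral.integral_of_le hu.1.le, ← gapPos_sub_gapPos_swap]
    exact (integral_sub (integrable_gapPos hμ hν).integrableOn
      (integrable_gapPos hν hμ).integrableOn).symm
  linarith [h.setIntegral_quantile_le hμ hν hu]

lemma DcxLE.gapDominated {μ ν : Measure ℝ} [IsProbabilityMeasure μ] [IsProbabilityMeasure ν]
    (hμ : Integrable (fun x : ℝ => x) μ) (hν : Integrable (fun x : ℝ => x) ν)
    (h : DcxLE μ ν) : GapDominated μ ν := by
  have hi := integrable_gapPos hμ hν
  have hi' := integrable_gapPos hν hμ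
  refine ⟨hi, hi', ?_⟩
  have hclosed : IsClosed {u | PsiPlus ν μ u ≤ PsiPlus μ ν u} :=
    isClosed_le (continuous_PsiPlus hi') (continuous_PsiPlus hi)
  rw [← closure_Ioo zero_ne_one]
  exact hclosed.closure_subset_iff.2 fun u hu => h.PsiPlus_swap_le hμ hν hu

namespace GapDominated

variable {μ ν : Measure ℝ} {u v : ℝ}

lemma PsiPlus_swap_one_le (h : GapDominated μ ν) : PsiPlus ν μ 1 ≤ PsiPlus μ ν 1 :=
  h.PsiPlus_swap_le 1 ⟨zero_le_one, le_rfl⟩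

lemma PsiPlus_swap_lt (h : GapDominated μ ν) (hu : u ∈ Ioo (0 : ℝ) 1)
    (hlt : quantile ν u < quantile μ u) : PsiPlus ν μ u < PsiPlus μ ν u := by
  obtain ⟨s, hs, hPsi, hgap⟩ := exists_PsiPlus_lt h.integrable hu hlt
  have hconst : PsiPlus ν μ u = PsiPlus ν μ s := by
    rw [PsiPlus, PsiPlus, ← sub_eq_zero,
      intervalIntegral.integral_interval_sub_left h.integrable_swap.intervalIntegrable
        h.integrable_swap.intervalIntegrable, intervalIntegral.integral_of_le hs.2.le]
    exact setIntegral_eq_zero_of_forall_eq_zero hgap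
  rw [hconst]
  exact (h.PsiPlus_swap_le s ⟨hs.1.le, hs.2.le.trans hu.2.le⟩).trans_lt hPsi

lemma uD_mem (h : GapDominated μ ν) : uD μ ν ∈ Icc (0 : ℝ) 1 := by
  rw [uD_eq_leftInv]
  exact (leftInv_mem (continuous_PsiPlus h.integrable) h.PsiPlus_swap_one_le).1

lemma mem_Ioo_of_mem (h : GapDominated μ ν) (hu : u ∈ Ioo 0 (uD μ ν)) : u ∈ Ioo (0 : ℝ) 1 :=
  Ioo_subset_Ioo_right h.uD_mem.2 hu

lemma PsiPlus_uD (h : GapDominated μ ν) : PsiPlus μ ν (uD μ ν) = PsiPlus ν μ 1 := by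
  rw [uD_eq_leftInv]
  refine apply_leftInv (continuous_PsiPlus h.integrable) ?_ h.PsiPlus_swap_one_le
  rw [PsiPlus_zero]
  exact PsiPlus_nonneg h.integrable_swap zero_le_one

lemma gammaD_eq (h : GapDominated μ ν) : gammaD μ ν = PsiPlus ν μ 1 := h.PsiPlus_uD

lemma gammaD_nonneg (h : GapDominated μ ν) : 0 ≤ gammaD μ ν :=
  PsiPlus_nonneg h.integrable h.uD_mem.1

lemma lt_uD_iff (h : GapDominated μ ν) (hu : u ∈ Icc (0 : ℝ) 1) :
    u < uD μ ν ↔ PsiPlus μ ν u < PsiPlus ν μ 1 := by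
  rw [← not_le, ← not_le, not_iff_not, uD_eq_leftInv, leftInv_le_iff
    (continuous_PsiPlus h.integrable) (monotone_PsiPlus h.integrable) h.PsiPlus_swap_one_le hu]

lemma gammaD_pos (h : GapDominated μ ν) (hpos : 0 < uD μ ν) : 0 < gammaD μ ν := by
  rwa [h.gammaD_eq, ← PsiPlus_zero μ ν, ← h.lt_uD_iff ⟨le_rfl, zero_le_one⟩]

lemma rhoPlus_eq_smul (h : GapDominated μ ν) :
    rhoPlus μ ν = ENNReal.ofReal (1 / gammaD μ ν) • densityOn (gapPos μ ν) (uD μ ν) :=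
  densityOn_const_mul (one_div_nonneg.2 h.gammaD_nonneg) _ _

lemma rhoMinus_eq_smul (h : GapDominated μ ν) :
    rhoMinus μ ν = ENNReal.ofReal (1 / gammaD μ ν) • densityOn (gapPos ν μ) 1 := by
  rw [rhoMinus_eq_densityOn, densityOn_const_mul (one_div_nonneg.2 h.gammaD_nonneg)]

lemma isProbabilityMeasure_rhoPlus (h : GapDominated μ ν) (hpos : 0 < uD μ ν) :
    IsProbabilityMeasure (rhoPlus μ ν) := by
  have hγ := h.gammaD_pos hpos
  refine ⟨?_⟩
  rw [h.rhoPlus_eq_smul, Measure.smul_apply, smul_eq_mul,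
    densityOn_univ h.integrable (gapPos_nonneg _ _) hpos.le, ← gammaD,
    ← ENNReal.ofReal_mul (one_div_nonneg.2 hγ.le), one_div_mul_cancel hγ.ne', ENNReal.ofReal_one]

lemma PsiPlus_phi (h : GapDominated μ ν) (hu : u ∈ Ioo 0 (uD μ ν)) :
    PsiPlus ν μ (phi μ ν u) = PsiPlus μ ν u := by
  rw [phi_eq_leftInv]
  refine apply_leftInv (continuous_PsiPlus h.integrable_swap) ?_
    ((h.lt_uD_iff (Ioo_subset_Icc_self (h.mem_Ioo_of_mem hu))).1 hu.2).le
  rw [PsiPlus_zero]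
  exact PsiPlus_nonneg h.integrable hu.1.le

lemma PsiPlus_phiTilde (h : GapDominated μ ν) (hv : v ∈ Ioo (0 : ℝ) 1) :
    PsiPlus μ ν (phiTilde μ ν v) = PsiPlus ν μ v := by
  rw [phiTilde_eq_leftInv]
  refine apply_leftInv (continuous_PsiPlus h.integrable) ?_
    ((monotone_PsiPlus h.integrable_swap hv.2.le).trans h.PsiPlus_swap_one_le)
  rw [PsiPlus_zero]
  exact PsiPlus_nonneg h.integrable_swap hv.1.le

lemma lt_phi (h : GapDominated μ ν) (hu : u ∈ carrierPlus μ ν) : u < phi μ ν u := by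
  have hlt := h.PsiPlus_swap_lt (h.mem_Ioo_of_mem hu.1) hu.2
  rw [← h.PsiPlus_phi hu.1] at hlt
  exact (monotone_PsiPlus h.integrable_swap).reflect_lt hlt

lemma phiTilde_pos (h : GapDominated μ ν) (hv : v ∈ carrierMinus μ ν) : 0 < phiTilde μ ν v := by
  obtain ⟨s, hs, hPsi, -⟩ := exists_PsiPlus_lt h.integrable_swap hv.1 hv.2
  refine (monotone_PsiPlus h.integrable).reflect_lt ?_
  rw [PsiPlus_zero, h.PsiPlus_phiTilde hv.1]
  exact (PsiPlus_nonneg h.integrable_swap hs.1.le).trans_lt hPsi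

lemma map_phi_rhoPlus (h : GapDominated μ ν) : (rhoPlus μ ν).map (phi μ ν) = rhoMinus μ ν := by
  have hi := h.integrable
  have hi' := h.integrable_swap
  have hinv := measurable_leftInv (continuous_PsiPlus hi') (monotone_PsiPlus hi')
  have hunif : (densityOn (gapPos μ ν) (uD μ ν)).map (PsiPlus μ ν)
      = (densityOn (gapPos ν μ) 1).map (PsiPlus ν μ) := by
    refine (map_primitive_densityOn hi (gapPos_nonneg μ ν) h.uD_mem).trans
      (Eq.trans ?_ (map_primitive_densityOn hi' (gapPos_nonneg ν μ) ⟨zero_le_one, le_rfl⟩).symm)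
    exact congrArg (fun c => volume.restrict (Ioo 0 c)) h.PsiPlus_uD
  have hcancel : leftInv (PsiPlus ν μ) ∘ PsiPlus ν μ =ᵐ[densityOn (gapPos ν μ) 1] id :=
    ae_leftInv_primitive hi' (gapPos_nonneg ν μ) ⟨zero_le_one, le_rfl⟩
  rw [h.rhoPlus_eq_smul, h.rhoMinus_eq_smul, Measure.map_smul, phi_eq_leftInv,
    ← Measure.map_map hinv (continuous_PsiPlus hi).measurable, hunif,
    Measure.map_map hinv (continuous_PsiPlus hi').measurable, Measure.map_congr hcancel,
    Measure.map_id]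

lemma ae_phiTilde_phi (h : GapDominated μ ν) :
    ∀ᵐ u ∂(rhoPlus μ ν), phiTilde μ ν (phi μ ν u) = u := by
  have hinv := ae_leftInv_primitive h.integrable (gapPos_nonneg μ ν) h.uD_mem
  have hmem := ae_rhoPlus_mem_carrierPlus μ ν
  rw [h.rhoPlus_eq_smul] at hmem ⊢
  filter_upwards [Measure.ae_smul_measure hinv _, hmem] with u hu hmem
  rw [phiTilde_eq_leftInv, Function.comp_apply, h.PsiPlus_phi hmem.1]
  exact hu

lemma map_phiTilde_rhoMinus (h : GapDominated μ ν) :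
    (rhoMinus μ ν).map (phiTilde μ ν) = rhoPlus μ ν := by
  rw [← h.map_phi_rhoPlus, Measure.map_map (measurable_phiTilde h.integrable h.integrable_swap)
    (measurable_phi h.integrable h.integrable_swap)]
  exact (Measure.map_congr (g := id) h.ae_phiTilde_phi).trans Measure.map_id

lemma ae_phi_mem_carrierMinus (h : GapDominated μ ν) :
    ∀ᵐ u ∂(rhoPlus μ ν), phi μ ν u ∈ carrierMinus μ ν :=
  ae_of_ae_map (measurable_phi h.integrable h.integrable_swap).aemeasurable
    (by rw [h.map_phi_rhoPlus]; exact ae_rhoMinus_mem_carrierMinus μ ν)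

lemma ae_phiTilde_mem_carrierPlus (h : GapDominated μ ν) :
    ∀ᵐ v ∂(rhoMinus μ ν), phiTilde μ ν v ∈ carrierPlus μ ν :=
  ae_of_ae_map (measurable_phiTilde h.integrable h.integrable_swap).aemeasurable
    (by rw [h.map_phiTilde_rhoMinus]; exact ae_rhoPlus_mem_carrierPlus μ ν)

end GapDominated

/-! ### Mixtures and the kernel `m̃^Q` -/

section Mixture

variable {μ ν : Measure ℝ} {u v : ℝ} {κ : Measure ℝ}

/-- For `κ`-almost every `v`, `F_μ⁻¹(u)` lies strictly between `F_ν⁻¹(u)` and `F_ν⁻¹(v)`: the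
condition under which `mixture μ ν u κ` is a probability measure with mean `F_μ⁻¹(u)`. -/
def Straddles (μ ν : Measure ℝ) (u : ℝ) (κ : Measure ℝ) : Prop :=
  ∀ᵐ v ∂κ, (quantile ν u < quantile μ u ∧ quantile μ u < quantile ν v) ∨
    (quantile μ u < quantile ν u ∧ quantile ν v < quantile μ u)

/-- The weight of `F_ν⁻¹(v)` when `F_μ⁻¹(u)` is written as a barycentre of `F_ν⁻¹(v)` and
`F_ν⁻¹(u)`. -/
def weight (μ ν : Measure ℝ) (u v : ℝ) : ℝ :=
  (quantile μ u - quantile ν u) / (quantile ν v - quantile ν u)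

/-- The weight of `F_ν⁻¹(u)` when `F_μ⁻¹(u)` is written as a barycentre of `F_ν⁻¹(v)` and
`F_ν⁻¹(u)`. -/
def coweight (μ ν : Measure ℝ) (u v : ℝ) : ℝ :=
  (quantile ν v - quantile μ u) / (quantile ν v - quantile ν u)

lemma measurable_weight (μ ν : Measure ℝ) : Measurable fun p : ℝ × ℝ => weight μ ν p.1 p.2 :=
  (((measurable_quantile μ).comp measurable_fst).sub
    ((measurable_quantile ν).comp measurable_fst)).div
    (((measurable_quantile ν).comp measurable_snd).sub
    ((measurable_quantile ν).comp measurable_fst))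

lemma measurable_coweight (μ ν : Measure ℝ) : Measurable fun p : ℝ × ℝ => coweight μ ν p.1 p.2 :=
  (((measurable_quantile ν).comp measurable_snd).sub
    ((measurable_quantile μ).comp measurable_fst)).div
    (((measurable_quantile ν).comp measurable_snd).sub
    ((measurable_quantile ν).comp measurable_fst))

lemma measurable_weight_right (μ ν : Measure ℝ) (u : ℝ) : Measurable (weight μ ν u) :=
  (measurable_weight μ ν).comp measurable_prodMk_left

lemma weight_eq_sub_swap_div_sub_swap (μ ν : Measure ℝ) (u v : ℝ) :
    weight μ ν u v = (quantile ν u - quantile μ u) / (quantile ν u - quantile ν v) := by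
  rw [weight, ← neg_div_neg_eq, neg_sub, neg_sub]

lemma coweight_eq_one_sub_weight (h : quantile ν v ≠ quantile ν u) :
    coweight μ ν u v = 1 - weight μ ν u v := by
  rw [coweight, weight, eq_sub_iff_add_eq, ← add_div, div_eq_one_iff_eq (sub_ne_zero.2 h)]
  ring

lemma weight_mul_quantile (h : quantile ν v ≠ quantile ν u) :
    weight μ ν u v * quantile ν v
      = quantile μ u - quantile ν u + weight μ ν u v * quantile ν u := by
  rw [← sub_eq_iff_eq_add, ← mul_sub, weight, div_mul_cancel₀ _ (sub_ne_zero.2 h)]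

namespace Straddles

lemma quantile_ne (h : Straddles μ ν u κ) : ∀ᵐ v ∂κ, quantile ν v ≠ quantile ν u := by
  filter_upwards [h] with v hv
  rcases hv with ⟨hlt, hlt'⟩ | ⟨hlt, hlt'⟩
  · exact (hlt.trans hlt').ne'
  · exact (hlt'.trans hlt).ne

lemma weight_mem (h : Straddles μ ν u κ) : ∀ᵐ v ∂κ, weight μ ν u v ∈ Icc (0 : ℝ) 1 := by
  filter_upwards [h] with v hv
  rcases hv with ⟨hlt, hlt'⟩ | ⟨hlt, hlt'⟩
  · exact ⟨div_nonneg (by linarith) (by linarith), (div_le_one (by linarith)).2 (by linarith)⟩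
  · exact ⟨div_nonneg_of_nonpos (by linarith) (by linarith),
      (div_le_one_of_neg (by linarith)).2 (by linarith)⟩

lemma lintegral_coweight_add_lintegral_weight (h : Straddles μ ν u κ) [IsProbabilityMeasure κ] :
    ∫⁻ v, ENNReal.ofReal (coweight μ ν u v) ∂κ + ∫⁻ v, ENNReal.ofReal (weight μ ν u v) ∂κ
      = 1 := by
  rw [← lintegral_add_right _ (measurable_weight_right μ ν u).ennreal_ofReal]
  refine (lintegral_congr_ae (g := fun _ => 1) ?_).trans (by simp)
  filter_upwards [h.quantile_ne, h.weight_mem] with v hne hv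
  rw [coweight_eq_one_sub_weight hne, ← ENNReal.ofReal_add (sub_nonneg.2 hv.2) hv.1,
    sub_add_cancel, ENNReal.ofReal_one]

lemma lintegral_weight_le_one (h : Straddles μ ν u κ) [IsProbabilityMeasure κ] :
    ∫⁻ v, ENNReal.ofReal (weight μ ν u v) ∂κ ≤ 1 :=
  h.lintegral_coweight_add_lintegral_weight ▸ le_add_self

lemma lintegral_coweight_ne_top (h : Straddles μ ν u κ) [IsProbabilityMeasure κ] :
    ∫⁻ v, ENNReal.ofReal (coweight μ ν u v) ∂κ ≠ ⊤ :=
  ne_top_of_le_ne_top ENNReal.one_ne_top (h.lintegral_coweight_add_lintegral_weight ▸ le_self_add)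

lemma integrable_weight (h : Straddles μ ν u κ) [IsProbabilityMeasure κ] :
    Integrable (weight μ ν u) κ := by
  refine Integrable.of_bound (measurable_weight_right μ ν u).aestronglyMeasurable 1 ?_
  filter_upwards [h.weight_mem] with v hv
  rw [Real.norm_eq_abs, abs_of_nonneg hv.1]
  exact hv.2

lemma toReal_lintegral_coweight (h : Straddles μ ν u κ) [IsProbabilityMeasure κ] :
    (∫⁻ v, ENNReal.ofReal (coweight μ ν u v) ∂κ).toReal = 1 - ∫ v, weight μ ν u v ∂κ := by
  have hco : ∀ᵐ v ∂κ, ENNReal.ofReal (coweight μ ν u v) = ENNReal.ofReal (1 - weight μ ν u v) := by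
    filter_upwards [h.quantile_ne] with v hne
    rw [coweight_eq_one_sub_weight hne]
  rw [lintegral_congr_ae hco, ← integral_eq_lintegral_of_nonneg_ae,
    integral_sub (integrable_const 1) h.integrable_weight]
  · simp
  · filter_upwards [h.weight_mem] with v hv using sub_nonneg.2 hv.2
  · exact ((measurable_weight_right μ ν u).const_sub 1).aestronglyMeasurable

end Straddles

lemma mixture_apply {B : Set ℝ} (hB : MeasurableSet B) :
    mixture μ ν u κ B
      = ∫⁻ v, ENNReal.ofReal (weight μ ν u v) * B.indicator 1 (quantile ν v) ∂κ
        + (∫⁻ v, ENNReal.ofReal (coweight μ ν u v) ∂κ) * B.indicator 1 (quantile ν u) := by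
  rw [mixture, Measure.add_apply, Measure.map_apply (measurable_quantile ν) hB,
    Measure.smul_apply, Measure.dirac_apply' _ hB, smul_eq_mul,
    withDensity_apply _ (measurable_quantile ν hB),
    ← lintegral_indicator (measurable_quantile ν hB)]
  congr 1
  refine lintegral_congr fun v => ?_
  by_cases hv : quantile ν v ∈ B
  · rw [indicator_of_mem (show v ∈ quantile ν ⁻¹' B from hv), indicator_of_mem hv]
    simp [weight]
  · rw [indicator_of_notMem (show v ∉ quantile ν ⁻¹' B from hv), indicator_of_notMem hv]
    simp

namespace Straddles

lemma isProbabilityMeasure_mixture (h : Straddles μ ν u κ) [IsProbabilityMeasure κ] :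
    IsProbabilityMeasure (mixture μ ν u κ) := by
  refine ⟨?_⟩
  rw [mixture_apply MeasurableSet.univ, add_comm]
  simpa using h.lintegral_coweight_add_lintegral_weight

lemma weight_smul_quantile (h : Straddles μ ν u κ) :
    (fun v => (ENNReal.ofReal (weight μ ν u v)).toReal • quantile ν v) =ᵐ[κ]
      fun v => quantile μ u - quantile ν u + weight μ ν u v * quantile ν u := by
  filter_upwards [h.quantile_ne, h.weight_mem] with v hne hv
  rw [ENNReal.toReal_ofReal hv.1, smul_eq_mul, weight_mul_quantile hne]

lemma integrable_map_withDensity_weight (h : Straddles μ ν u κ) [IsProbabilityMeasure κ] :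
    Integrable (fun y : ℝ => y)
      ((κ.withDensity fun v => ENNReal.ofReal (weight μ ν u v)).map (quantile ν)) := by
  refine (integrable_map_measure aestronglyMeasurable_id
    (measurable_quantile ν).aemeasurable).2 ?_
  refine (integrable_withDensity_iff_integrable_smul'
    (measurable_weight_right μ ν u).ennreal_ofReal
    (ae_of_all _ fun _ => ENNReal.ofReal_lt_top)).2 ?_
  exact ((integrable_const _).add (h.integrable_weight.mul_const _)).congr
    h.weight_smul_quantile.symm

lemma integral_map_withDensity_weight (h : Straddles μ ν u κ) [IsProbabilityMeasure κ] :
    ∫ y, y ∂((κ.withDensity fun v => ENNReal.ofReal (weight μ ν u v)).map (quantile ν))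
      = quantile μ u - quantile ν u + (∫ v, weight μ ν u v ∂κ) * quantile ν u := by
  rw [integral_map (f := fun y : ℝ => y) (measurable_quantile ν).aemeasurable
      aestronglyMeasurable_id,
    integral_withDensity_eq_integral_toReal_smul (measurable_weight_right μ ν u).ennreal_ofReal
      (ae_of_all _ fun _ => ENNReal.ofReal_lt_top),
    integral_congr_ae h.weight_smul_quantile,
    integral_add (integrable_const _) (h.integrable_weight.mul_const _), integral_mul_const]
  simp

lemma integrable_smul_dirac (h : Straddles μ ν u κ) [IsProbabilityMeasure κ] :
    Integrable (fun y : ℝ => y)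
      ((∫⁻ v, ENNReal.ofReal (coweight μ ν u v) ∂κ) • Measure.dirac (quantile ν u)) :=
  (integrable_dirac (by simp)).smul_measure h.lintegral_coweight_ne_top

lemma integral_mixture (h : Straddles μ ν u κ) [IsProbabilityMeasure κ] :
    ∫ y, y ∂(mixture μ ν u κ) = quantile μ u := by
  refine (integral_add_measure h.integrable_map_withDensity_weight
    h.integrable_smul_dirac).trans ?_
  rw [h.integral_map_withDensity_weight, integral_smul_measure, integral_dirac,
    h.toReal_lintegral_coweight, smul_eq_mul]
  ring

/-- The exchanged mass is added on both sides so that no subtraction occurs. -/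
lemma mixture_apply_add (h : Straddles μ ν u κ) [IsProbabilityMeasure κ] {B : Set ℝ}
    (hB : MeasurableSet B) :
    mixture μ ν u κ B + ∫⁻ v, ENNReal.ofReal (weight μ ν u v) * B.indicator 1 (quantile ν u) ∂κ
      = B.indicator 1 (quantile ν u)
        + ∫⁻ v, ENNReal.ofReal (weight μ ν u v) * B.indicator 1 (quantile ν v) ∂κ := by
  rw [mixture_apply hB, lintegral_mul_const _ (measurable_weight_right μ ν u).ennreal_ofReal,
    add_assoc, ← add_mul, h.lintegral_coweight_add_lintegral_weight, one_mul, add_comm]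

end Straddles

lemma measurable_mixture (μ ν : Measure ℝ) (π : Kernel ℝ ℝ) [IsFiniteKernel π] :
    Measurable fun u => mixture μ ν u (π u) := by
  refine Measure.measurable_of_measurable_coe _ fun B hB => ?_
  simp_rw [mixture_apply hB]
  have hind : Measurable (B.indicator (1 : ℝ → ENNReal)) := measurable_one.indicator hB
  have hmoved : Measurable fun p : ℝ × ℝ =>
      ENNReal.ofReal (weight μ ν p.1 p.2) * B.indicator 1 (quantile ν p.2) :=
    (measurable_weight μ ν).ennreal_ofReal.mul
      (hind.comp ((measurable_quantile ν).comp measurable_snd))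
  exact hmoved.lintegral_kernel_prod_right.add
    ((measurable_coweight μ ν).ennreal_ofReal.lintegral_kernel_prod_right.mul
      (hind.comp (measurable_quantile ν)))

end Mixture

section MTilde

variable {μ ν : Measure ℝ} {πp πm : Kernel ℝ ℝ} {u : ℝ}

lemma measurableSet_quantile_lt_right (μ ν : Measure ℝ) :
    MeasurableSet {p : ℝ × ℝ | p.2 ∈ Ioo (0 : ℝ) 1 ∧ quantile μ p.1 < quantile ν p.2} :=
  (measurable_snd measurableSet_Ioo).inter (measurableSet_lt
    ((measurable_quantile μ).comp measurable_fst) ((measurable_quantile ν).comp measurable_snd))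

lemma measurableSet_quantile_lt_left (μ ν : Measure ℝ) :
    MeasurableSet {p : ℝ × ℝ | p.2 ∈ Ioo (0 : ℝ) 1 ∧ quantile ν p.2 < quantile μ p.1} :=
  (measurable_snd measurableSet_Ioo).inter (measurableSet_lt
    ((measurable_quantile ν).comp measurable_snd) ((measurable_quantile μ).comp measurable_fst))

lemma isProbabilityMeasure_of_apply_eq_one {α : Type*} [MeasurableSpace α] {κ : Measure α}
    {s : Set α} (hκ : κ univ ≤ 1) (h : κ s = 1) : IsProbabilityMeasure κ :=
  ⟨le_antisymm hκ (h ▸ measure_mono (subset_univ s))⟩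

lemma straddles_of_quantile_lt_right {κ : Measure ℝ} [IsProbabilityMeasure κ]
    (hlt : quantile ν u < quantile μ u)
    (h : κ {v | v ∈ Ioo (0 : ℝ) 1 ∧ quantile μ u < quantile ν v} = 1) : Straddles μ ν u κ := by
  have hmeas := measurable_prodMk_left (x := u) (measurableSet_quantile_lt_right μ ν)
  filter_upwards [(mem_ae_iff_prob_eq_one hmeas).2 h] with v hv using Or.inl ⟨hlt, hv.2⟩

lemma straddles_of_quantile_lt_left {κ : Measure ℝ} [IsProbabilityMeasure κ]
    (hlt : quantile μ u < quantile ν u)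
    (h : κ {v | v ∈ Ioo (0 : ℝ) 1 ∧ quantile ν v < quantile μ u} = 1) : Straddles μ ν u κ := by
  have hmeas := measurable_prodMk_left (x := u) (measurableSet_quantile_lt_left μ ν)
  filter_upwards [(mem_ae_iff_prob_eq_one hmeas).2 h] with v hv using Or.inr ⟨hlt, hv.2⟩

lemma measurable_mTilde (μ ν : Measure ℝ) (πp πm : Kernel ℝ ℝ) [IsFiniteKernel πp]
    [IsFiniteKernel πm] : Measurable (mTilde μ ν πp πm) := by
  classical
  have hplus : MeasurableSet {u : ℝ | quantile ν u < quantile μ u ∧ u ∈ Ioo 0 (uD μ ν) ∧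
      πp u {v | v ∈ Ioo (0 : ℝ) 1 ∧ quantile μ u < quantile ν v} = 1} :=
    (measurableSet_lt (measurable_quantile ν) (measurable_quantile μ)).inter
      (measurableSet_Ioo.inter ((Kernel.measurable_kernel_prodMk_left (κ := πp)
        (measurableSet_quantile_lt_right μ ν)) (measurableSet_singleton 1)))
  have hminus : MeasurableSet {u : ℝ | quantile μ u < quantile ν u ∧ u ∈ Ioo (0 : ℝ) 1 ∧
      πm u {v | v ∈ Ioo (0 : ℝ) 1 ∧ quantile ν v < quantile μ u} = 1} :=
    (measurableSet_lt (measurable_quantile μ) (measurable_quantile ν)).inter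
      (measurableSet_Ioo.inter ((Kernel.measurable_kernel_prodMk_left (κ := πm)
        (measurableSet_quantile_lt_left μ ν)) (measurableSet_singleton 1)))
  exact Measurable.ite hplus (measurable_mixture μ ν πp) (Measurable.ite hminus
    (measurable_mixture μ ν πm) (Measure.measurable_dirac.comp (measurable_quantile ν)))

lemma isProbabilityMeasure_mTilde (hp : ∀ u, πp u univ ≤ 1) (hm : ∀ u, πm u univ ≤ 1) (u : ℝ) :
    IsProbabilityMeasure (mTilde μ ν πp πm u) := by
  unfold mTilde
  split_ifs with hplus hminus
  · have := isProbabilityMeasure_of_apply_eq_one (hp u) hplus.2.2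
    exact (straddles_of_quantile_lt_right hplus.1 hplus.2.2).isProbabilityMeasure_mixture
  · have := isProbabilityMeasure_of_apply_eq_one (hm u) hminus.2.2
    exact (straddles_of_quantile_lt_left hminus.1 hminus.2.2).isProbabilityMeasure_mixture
  · infer_instance

end MTilde

section Disintegration

variable {α β : Type*} [MeasurableSpace α] [MeasurableSpace β] {π : Kernel α β}

lemma isFiniteKernel_of_le_one (hπ : ∀ a, π a univ ≤ 1) : IsFiniteKernel π :=
  ⟨⟨1, ENNReal.one_lt_top, hπ⟩⟩

lemma ae_isProbabilityMeasure_of_compProd {ρ : Measure α} [IsProbabilityMeasure ρ]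
    [IsProbabilityMeasure (ρ ⊗ₘ π)] (hπ : ∀ a, π a univ ≤ 1) :
    ∀ᵐ a ∂ρ, IsProbabilityMeasure (π a) := by
  have := isFiniteKernel_of_le_one hπ
  have hmean : ∫⁻ a, π a univ ∂ρ = 1 := by
    rw [← measure_univ (μ := ρ ⊗ₘ π), Measure.compProd_apply MeasurableSet.univ]
    rfl
  have hmass : (fun a => π a univ) =ᵐ[ρ] fun _ => 1 :=
    ae_eq_of_ae_le_of_lintegral_le (ae_of_all _ hπ) (by simp [hmean]) aemeasurable_const
      (by simp [hmean])
  filter_upwards [hmass] with a ha using ⟨ha⟩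

lemma ae_apply_eq_one_of_ae_compProd {ρ : Measure α} [IsProbabilityMeasure ρ]
    [IsProbabilityMeasure (ρ ⊗ₘ π)] (hπ : ∀ a, π a univ ≤ 1) {p : α × β → Prop}
    (h : ∀ᵐ x ∂(ρ ⊗ₘ π), p x) : ∀ᵐ a ∂ρ, π a {b | p (a, b)} = 1 := by
  have := isFiniteKernel_of_le_one hπ
  filter_upwards [ae_isProbabilityMeasure_of_compProd hπ, Measure.ae_ae_of_ae_compProd h]
    with a hprob hae
  rw [← measure_univ (μ := π a)]
  exact measure_congr (eventuallyEq_univ.2 hae)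

end Disintegration

section ActiveKernel

variable {μ ν : Measure ℝ} {Q : Measure (ℝ × ℝ)} {πp πm : Kernel ℝ ℝ} {u : ℝ}

lemma IsQd.isProbabilityMeasure_rhoPlus (hQ : IsQd μ ν Q) : IsProbabilityMeasure (rhoPlus μ ν) :=
  have := hQ.prob
  hQ.fst_eq ▸ Measure.isProbabilityMeasure_map measurable_fst.aemeasurable

lemma IsQd.isProbabilityMeasure_rhoMinus (hQ : IsQd μ ν Q) :
    IsProbabilityMeasure (rhoMinus μ ν) :=
  have := hQ.prob
  hQ.snd_eq ▸ Measure.isProbabilityMeasure_map measurable_snd.aemeasurable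

lemma IsQd.gammaD_pos (hQ : IsQd μ ν Q) (h : GapDominated μ ν) : 0 < gammaD μ ν := by
  refine h.gammaD_nonneg.lt_of_ne fun hzero => ?_
  have hprob := hQ.isProbabilityMeasure_rhoPlus
  have hrho : rhoPlus μ ν = 0 := by simp [h.rhoPlus_eq_smul, ← hzero]
  exact IsProbabilityMeasure.ne_zero _ hrho

lemma measurableSet_Qd_support (μ ν : Measure ℝ) :
    MeasurableSet {p : ℝ × ℝ | p.1 ∈ Ioo 0 (uD μ ν) ∧ p.2 ∈ Ioo (0 : ℝ) 1 ∧ p.1 < p.2} :=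
  (measurable_fst measurableSet_Ioo).inter ((measurable_snd measurableSet_Ioo).inter
    (measurableSet_lt measurable_fst measurable_snd))

lemma IsQd.ae_mem (hQ : IsQd μ ν Q) :
    ∀ᵐ p ∂Q, p.1 ∈ Ioo 0 (uD μ ν) ∧ p.2 ∈ Ioo (0 : ℝ) 1 ∧ p.1 < p.2 :=
  have := hQ.prob
  (mem_ae_iff_prob_eq_one (measurableSet_Qd_support μ ν)).2 hQ.lt_ae

lemma IsQd.ae_quantile_lt (hQ : IsQd μ ν Q) (h : GapDominated μ ν) :
    ∀ᵐ p ∂Q, p.1 ∈ Ioo (0 : ℝ) 1 ∧ p.2 ∈ Ioo (0 : ℝ) 1 ∧ quantile μ p.1 < quantile ν p.2 ∧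
      quantile ν p.1 < quantile μ p.2 := by
  have hfst : ∀ᵐ p ∂Q, p.1 ∈ carrierPlus μ ν :=
    ae_of_ae_map measurable_fst.aemeasurable (hQ.fst_eq ▸ ae_rhoPlus_mem_carrierPlus μ ν)
  have hsnd : ∀ᵐ p ∂Q, p.2 ∈ carrierMinus μ ν :=
    ae_of_ae_map measurable_snd.aemeasurable (hQ.snd_eq ▸ ae_rhoMinus_mem_carrierMinus μ ν)
  filter_upwards [hQ.ae_mem, hfst, hsnd] with p hp hp₁ hp₂
  have hmem := h.mem_Ioo_of_mem hp₁.1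
  have hmono : quantile μ p.1 ≤ quantile μ p.2 := monotoneOn_quantile hmem hp₂.1 hp.2.2.le
  exact ⟨hmem, hp₂.1, hmono.trans_lt hp₂.2, hp₁.2.trans_le hmono⟩

namespace IsDisintegration

lemma isFiniteKernel_plus (hd : IsDisintegration μ ν Q πp πm) : IsFiniteKernel πp :=
  isFiniteKernel_of_le_one hd.plus_le

lemma isFiniteKernel_minus (hd : IsDisintegration μ ν Q πp πm) : IsFiniteKernel πm :=
  isFiniteKernel_of_le_one hd.minus_le

lemma map_swap_eq (hd : IsDisintegration μ ν Q πp πm) :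
    Q.map Prod.swap = rhoMinus μ ν ⊗ₘ πm := by
  rw [hd.eq_minus, Measure.map_map measurable_swap measurable_swap, Prod.swap_swap_eq,
    Measure.map_id]

lemma ae_plus_apply_eq_one (hd : IsDisintegration μ ν Q πp πm) (hQ : IsQd μ ν Q)
    (h : GapDominated μ ν) : ∀ᵐ u, u ∈ carrierPlus μ ν →
      πp u {v | v ∈ Ioo (0 : ℝ) 1 ∧ quantile μ u < quantile ν v} = 1 := by
  have hae := hQ.ae_quantile_lt h
  have := hQ.isProbabilityMeasure_rhoPlus
  have : IsProbabilityMeasure (rhoPlus μ ν ⊗ₘ πp) := hd.eq_plus ▸ hQ.prob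
  rw [hd.eq_plus] at hae
  rw [← ae_rhoPlus_iff (hQ.gammaD_pos h)]
  exact ae_apply_eq_one_of_ae_compProd (p := fun p : ℝ × ℝ => p.2 ∈ Ioo (0 : ℝ) 1 ∧
    quantile μ p.1 < quantile ν p.2) hd.plus_le (hae.mono fun p hp => ⟨hp.2.1, hp.2.2.1⟩)

lemma ae_minus_apply_eq_one (hd : IsDisintegration μ ν Q πp πm) (hQ : IsQd μ ν Q)
    (h : GapDominated μ ν) : ∀ᵐ v, v ∈ carrierMinus μ ν →
      πm v {u | u ∈ Ioo (0 : ℝ) 1 ∧ quantile ν u < quantile μ v} = 1 := by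
  have := hQ.prob
  have := hQ.isProbabilityMeasure_rhoMinus
  have : IsProbabilityMeasure (rhoMinus μ ν ⊗ₘ πm) :=
    hd.map_swap_eq ▸ Measure.isProbabilityMeasure_map measurable_swap.aemeasurable
  have hae : ∀ᵐ p ∂(rhoMinus μ ν ⊗ₘ πm),
      p.2 ∈ Ioo (0 : ℝ) 1 ∧ quantile ν p.2 < quantile μ p.1 := by
    rw [← hd.map_swap_eq,
      ae_map_iff measurable_swap.aemeasurable (measurableSet_quantile_lt_left μ ν)]
    filter_upwards [hQ.ae_quantile_lt h] with p hp using ⟨hp.1, hp.2.2.2⟩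
  rw [← ae_rhoMinus_iff (hQ.gammaD_pos h)]
  exact ae_apply_eq_one_of_ae_compProd hd.minus_le hae

end IsDisintegration

open Classical in
/-- The kernel `π₊` on the points with `F_μ⁻¹ > F_ν⁻¹` left of `u_d` and `π₋` on those with
`F_μ⁻¹ < F_ν⁻¹`: it gives the partners with which `u` exchanges mass. -/
def activeKernel (μ ν : Measure ℝ) (πp πm : Kernel ℝ ℝ) : Kernel ℝ ℝ :=
  Kernel.piecewise (measurableSet_carrierPlus μ ν) πp
    (Kernel.piecewise (measurableSet_carrierMinus μ ν) πm 0)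

lemma activeKernel_of_mem_carrierPlus (hu : u ∈ carrierPlus μ ν) :
    activeKernel μ ν πp πm u = πp u :=
  if_pos hu

lemma activeKernel_of_mem_carrierMinus (hu : u ∈ carrierMinus μ ν) :
    activeKernel μ ν πp πm u = πm u :=
  (if_neg (disjoint_right.1 (disjoint_carriers μ ν) hu)).trans (if_pos hu)

lemma activeKernel_of_notMem (hu : u ∉ carrierPlus μ ν) (hu' : u ∉ carrierMinus μ ν) :
    activeKernel μ ν πp πm u = 0 :=
  (if_neg hu).trans (if_neg hu')

lemma IsDisintegration.isFiniteKernel_activeKernel (hd : IsDisintegration μ ν Q πp πm) :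
    IsFiniteKernel (activeKernel μ ν πp πm) :=
  have := hd.isFiniteKernel_plus
  have := hd.isFiniteKernel_minus
  by unfold activeKernel; infer_instance

lemma lintegral_activeKernel (F : ℝ × ℝ → ENNReal) (u : ℝ) :
    ∫⁻ v, F (u, v) ∂(activeKernel μ ν πp πm u)
      = (carrierPlus μ ν).indicator (fun u => ∫⁻ v, F (u, v) ∂(πp u)) u
        + (carrierMinus μ ν).indicator (fun u => ∫⁻ v, F (u, v) ∂(πm u)) u := by
  by_cases hp : u ∈ carrierPlus μ ν
  · rw [activeKernel_of_mem_carrierPlus hp, indicator_of_mem hp,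
      indicator_of_notMem (disjoint_left.1 (disjoint_carriers μ ν) hp), add_zero]
  · by_cases hm : u ∈ carrierMinus μ ν
    · rw [activeKernel_of_mem_carrierMinus hm, indicator_of_notMem hp, indicator_of_mem hm,
        zero_add]
    · simp [activeKernel_of_notMem hp hm, hp, hm]

/-- `u` exchanges mass with its partners through a mixture with mean `F_μ⁻¹(u)`, or all of its
mass stays at `F_ν⁻¹(u) ≤ F_μ⁻¹(u)`. -/
def MTildeSplit (μ ν : Measure ℝ) (πp πm : Kernel ℝ ℝ) (u : ℝ) : Prop :=
  (IsProbabilityMeasure (activeKernel μ ν πp πm u) ∧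
      Straddles μ ν u (activeKernel μ ν πp πm u) ∧
      mTilde μ ν πp πm u = mixture μ ν u (activeKernel μ ν πp πm u)) ∨
    (activeKernel μ ν πp πm u = 0 ∧ quantile ν u ≤ quantile μ u ∧
      mTilde μ ν πp πm u = Measure.dirac (quantile ν u))

lemma IsDisintegration.ae_mTildeSplit (hd : IsDisintegration μ ν Q πp πm) (hQ : IsQd μ ν Q)
    (h : GapDominated μ ν) :
    ∀ᵐ u ∂(volume.restrict (Ioo (0 : ℝ) 1)), MTildeSplit μ ν πp πm u := by
  filter_upwards [ae_restrict_mem measurableSet_Ioo,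
    ae_restrict_of_ae (hd.ae_plus_apply_eq_one hQ h),
    ae_restrict_of_ae (hd.ae_minus_apply_eq_one hQ h)] with u hu hplus hminus
  by_cases hp : u ∈ carrierPlus μ ν
  · rw [MTildeSplit, activeKernel_of_mem_carrierPlus hp]
    have hprob := isProbabilityMeasure_of_apply_eq_one (hd.plus_le u) (hplus hp)
    exact Or.inl ⟨hprob, straddles_of_quantile_lt_right hp.2 (hplus hp),
      if_pos ⟨hp.2, hp.1, hplus hp⟩⟩
  have hnp : ¬ (quantile ν u < quantile μ u ∧ u ∈ Ioo 0 (uD μ ν) ∧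
      πp u {v | v ∈ Ioo (0 : ℝ) 1 ∧ quantile μ u < quantile ν v} = 1) :=
    fun hc => hp ⟨hc.2.1, hc.1⟩
  by_cases hm : u ∈ carrierMinus μ ν
  · rw [MTildeSplit, activeKernel_of_mem_carrierMinus hm]
    have hprob := isProbabilityMeasure_of_apply_eq_one (hd.minus_le u) (hminus hm)
    exact Or.inl ⟨hprob, straddles_of_quantile_lt_left hm.2 (hminus hm),
      (if_neg hnp).trans (if_pos ⟨hm.2, hu, hminus hm⟩)⟩
  · exact Or.inr ⟨activeKernel_of_notMem hp hm, not_lt.1 fun hlt => hm ⟨hu, hlt⟩,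
      (if_neg hnp).trans (if_neg fun hc => hm ⟨hu, hc.1⟩)⟩

end ActiveKernel

/-! ### The second marginal and the barycentres of `m̃^Q` -/

section Marginal

variable {μ ν : Measure ℝ} {Q : Measure (ℝ × ℝ)} {πp πm : Kernel ℝ ℝ} {u γ : ℝ}
  {F : ℝ × ℝ → ENNReal}

lemma lintegral_densityOn_compProd {g : ℝ → ℝ} (hg : Measurable g) (c : ℝ) {π : Kernel ℝ ℝ}
    [IsFiniteKernel π] (hF : Measurable F) :
    ∫⁻ p, F p ∂(densityOn g c ⊗ₘ π)
      = ∫⁻ u in Ioo 0 c, ENNReal.ofReal (g u) * ∫⁻ v, F (u, v) ∂(π u) := by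
  have : SFinite (densityOn g c) := by unfold densityOn; infer_instance
  rw [Measure.lintegral_compProd hF, densityOn, lintegral_withDensity_eq_lintegral_mul _
    hg.ennreal_ofReal hF.lintegral_kernel_prod_right']
  rfl

lemma ofReal_weight_of_le (hγ : 0 < γ) (hu : quantile ν u ≤ quantile μ u) (v : ℝ) :
    ENNReal.ofReal (weight μ ν u v) = ENNReal.ofReal (1 / γ * gapPos μ ν u) *
      ENNReal.ofReal (γ / (quantile ν v - quantile ν u)) := by
  rw [← ENNReal.ofReal_mul (mul_nonneg (by positivity) (gapPos_nonneg μ ν u)), gapPos,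
    max_eq_left (sub_nonneg.2 hu), weight]
  congr 1
  field_simp

lemma ofReal_weight_of_ge (hγ : 0 < γ) (hu : quantile μ u ≤ quantile ν u) (v : ℝ) :
    ENNReal.ofReal (weight μ ν u v) = ENNReal.ofReal (1 / γ * gapPos ν μ u) *
      ENNReal.ofReal (γ / (quantile ν u - quantile ν v)) := by
  rw [← ENNReal.ofReal_mul (mul_nonneg (by positivity) (gapPos_nonneg ν μ u)), gapPos,
    max_eq_left (sub_nonneg.2 hu), weight_eq_sub_swap_div_sub_swap]
  congr 1
  field_simp

/-- The rate at which `u` and `v` exchange mass under `Q(du,dv)`. -/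
def exchangeRate (μ ν : Measure ℝ) (p : ℝ × ℝ) : ENNReal :=
  ENNReal.ofReal (gammaD μ ν / (quantile ν p.2 - quantile ν p.1))

lemma measurable_exchangeRate (μ ν : Measure ℝ) : Measurable (exchangeRate μ ν) :=
  (measurable_const.div (((measurable_quantile ν).comp measurable_snd).sub
    ((measurable_quantile ν).comp measurable_fst))).ennreal_ofReal

lemma IsDisintegration.setLIntegral_carrierPlus_weight (hd : IsDisintegration μ ν Q πp πm)
    (hγ : 0 < gammaD μ ν) (hF : Measurable F) :
    ∫⁻ u in carrierPlus μ ν, ∫⁻ v, ENNReal.ofReal (weight μ ν u v) * F (u, v) ∂(πp u)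
      = ∫⁻ p, exchangeRate μ ν p * F p ∂Q := by
  have := hd.isFiniteKernel_plus
  have hG : Measurable fun p : ℝ × ℝ => exchangeRate μ ν p * F p :=
    (measurable_exchangeRate μ ν).mul hF
  rw [hd.eq_plus, rhoPlus_eq_densityOn,
    lintegral_densityOn_compProd ((measurable_gapPos μ ν).const_mul _) _ hG,
    ← inter_eq_self_of_subset_left (fun u hu => hu.1 : carrierPlus μ ν ⊆ Ioo 0 (uD μ ν)),
    ← setLIntegral_indicator (measurableSet_carrierPlus μ ν)]
  refine setLIntegral_congr_fun measurableSet_Ioo fun u hu => ?_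
  by_cases hlt : quantile ν u < quantile μ u
  · rw [indicator_of_mem (show u ∈ carrierPlus μ ν from ⟨hu, hlt⟩),
      ← lintegral_const_mul' _ _ ENNReal.ofReal_ne_top]
    simp_rw [ofReal_weight_of_le hγ hlt.le, mul_assoc]
    rfl
  · have hgap : gapPos μ ν u = 0 := max_eq_right (sub_nonpos.2 (not_lt.1 hlt))
    rw [indicator_of_notMem fun hmem => hlt hmem.2]
    simp [hgap]

lemma IsDisintegration.setLIntegral_carrierMinus_weight (hd : IsDisintegration μ ν Q πp πm)
    (hγ : 0 < gammaD μ ν) (hF : Measurable F) :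
    ∫⁻ u in carrierMinus μ ν, ∫⁻ v, ENNReal.ofReal (weight μ ν u v) * F (u, v) ∂(πm u)
      = ∫⁻ p, exchangeRate μ ν p * F p.swap ∂Q := by
  have := hd.isFiniteKernel_minus
  have hG : Measurable fun p : ℝ × ℝ => exchangeRate μ ν p * F p.swap :=
    (measurable_exchangeRate μ ν).mul (hF.comp measurable_swap)
  have hG' : Measurable fun p : ℝ × ℝ => exchangeRate μ ν p.swap * F p :=
    hG.comp measurable_swap
  rw [hd.eq_minus, lintegral_map hG measurable_swap, rhoMinus_eq_densityOn]
  simp only [Prod.swap_swap]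
  rw [lintegral_densityOn_compProd ((measurable_gapPos ν μ).const_mul _) _ hG',
    ← inter_eq_self_of_subset_left (fun u hu => hu.1 : carrierMinus μ ν ⊆ Ioo 0 1),
    ← setLIntegral_indicator (measurableSet_carrierMinus μ ν)]
  refine setLIntegral_congr_fun measurableSet_Ioo fun u hu => ?_
  by_cases hlt : quantile μ u < quantile ν u
  · rw [indicator_of_mem (show u ∈ carrierMinus μ ν from ⟨hu, hlt⟩),
      ← lintegral_const_mul' _ _ ENNReal.ofReal_ne_top]
    simp_rw [ofReal_weight_of_ge hγ hlt.le, mul_assoc]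
    rfl
  · have hgap : gapPos ν μ u = 0 := max_eq_right (sub_nonpos.2 (not_lt.1 hlt))
    rw [indicator_of_notMem fun hmem => hlt hmem.2]
    simp [hgap]

lemma IsDisintegration.lintegral_weight_activeKernel (hd : IsDisintegration μ ν Q πp πm)
    (hQ : IsQd μ ν Q) (h : GapDominated μ ν) (hF : Measurable F) :
    ∫⁻ u in Ioo (0 : ℝ) 1,
        ∫⁻ v, ENNReal.ofReal (weight μ ν u v) * F (u, v) ∂(activeKernel μ ν πp πm u)
      = ∫⁻ p, exchangeRate μ ν p * F p ∂Q + ∫⁻ p, exchangeRate μ ν p * F p.swap ∂Q := by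
  have := hd.isFiniteKernel_plus
  have hγ := hQ.gammaD_pos h
  have hplus : carrierPlus μ ν ⊆ Ioo (0 : ℝ) 1 := fun u hu => h.mem_Ioo_of_mem hu.1
  have hminus : carrierMinus μ ν ⊆ Ioo (0 : ℝ) 1 := fun u hu => hu.1
  have hwF : Measurable fun p : ℝ × ℝ => ENNReal.ofReal (weight μ ν p.1 p.2) * F p :=
    (measurable_weight μ ν).ennreal_ofReal.mul hF
  refine (lintegral_congr fun u => lintegral_activeKernel
    (fun p : ℝ × ℝ => ENNReal.ofReal (weight μ ν p.1 p.2) * F p) u).trans ?_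
  rw [lintegral_add_left
      (hwF.lintegral_kernel_prod_right'.indicator (measurableSet_carrierPlus μ ν)),
    setLIntegral_indicator (measurableSet_carrierPlus μ ν),
    setLIntegral_indicator (measurableSet_carrierMinus μ ν),
    inter_eq_self_of_subset_left hplus, inter_eq_self_of_subset_left hminus,
    hd.setLIntegral_carrierPlus_weight hγ hF, hd.setLIntegral_carrierMinus_weight hγ hF]

lemma IsDisintegration.lintegral_weight_activeKernel_swap (hd : IsDisintegration μ ν Q πp πm)
    (hQ : IsQd μ ν Q) (h : GapDominated μ ν) (hF : Measurable F) :
    ∫⁻ u in Ioo (0 : ℝ) 1,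
        ∫⁻ v, ENNReal.ofReal (weight μ ν u v) * F (v, u) ∂(activeKernel μ ν πp πm u)
      = ∫⁻ u in Ioo (0 : ℝ) 1,
        ∫⁻ v, ENNReal.ofReal (weight μ ν u v) * F (u, v) ∂(activeKernel μ ν πp πm u) :=
  (hd.lintegral_weight_activeKernel hQ h (hF.comp measurable_swap)).trans
    ((add_comm _ _).trans (hd.lintegral_weight_activeKernel hQ h hF).symm)

lemma MTildeSplit.apply_add {B : Set ℝ} (hsplit : MTildeSplit μ ν πp πm u)
    (hB : MeasurableSet B) :
    mTilde μ ν πp πm u B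
        + ∫⁻ v, ENNReal.ofReal (weight μ ν u v) * B.indicator 1 (quantile ν u)
          ∂(activeKernel μ ν πp πm u)
      = B.indicator 1 (quantile ν u)
        + ∫⁻ v, ENNReal.ofReal (weight μ ν u v) * B.indicator 1 (quantile ν v)
          ∂(activeKernel μ ν πp πm u) := by
  rcases hsplit with ⟨hprob, hs, hmix⟩ | ⟨hzero, -, hdirac⟩
  · rw [hmix, hs.mixture_apply_add hB]
  · rw [hzero, hdirac, lintegral_zero_measure, lintegral_zero_measure, Measure.dirac_apply' _ hB]

lemma MTildeSplit.lintegral_weight_le_one (hsplit : MTildeSplit μ ν πp πm u) :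
    ∫⁻ v, ENNReal.ofReal (weight μ ν u v) ∂(activeKernel μ ν πp πm u) ≤ 1 := by
  rcases hsplit with ⟨hprob, hs, -⟩ | ⟨hzero, -, -⟩
  · exact hs.lintegral_weight_le_one
  · simp [hzero]

lemma MTildeSplit.integral_le (hsplit : MTildeSplit μ ν πp πm u) :
    ∫ y, y ∂(mTilde μ ν πp πm u) ≤ quantile μ u := by
  rcases hsplit with ⟨hprob, hs, hmix⟩ | ⟨-, hle, hdirac⟩
  · rw [hmix, hs.integral_mixture]
  · rwa [hdirac, integral_dirac]

lemma IsDisintegration.lintegral_weight_activeKernel_ne_top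
    (hd : IsDisintegration μ ν Q πp πm) (hQ : IsQd μ ν Q) (h : GapDominated μ ν)
    (hF : ∀ p, F p ≤ 1) :
    ∫⁻ u in Ioo (0 : ℝ) 1,
      ∫⁻ v, ENNReal.ofReal (weight μ ν u v) * F (u, v) ∂(activeKernel μ ν πp πm u) ≠ ⊤ := by
  refine ne_top_of_le_ne_top ENNReal.one_ne_top
    ((lintegral_mono_ae (g := fun _ => 1) ?_).trans (by simp))
  filter_upwards [hd.ae_mTildeSplit hQ h] with u hu
  exact (lintegral_mono fun v => mul_le_of_le_one_right' (hF (u, v))).trans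
    hu.lintegral_weight_le_one

lemma IsDisintegration.lintegral_mTilde_apply [IsProbabilityMeasure ν]
    (hd : IsDisintegration μ ν Q πp πm) (hQ : IsQd μ ν Q) (h : GapDominated μ ν) {B : Set ℝ}
    (hB : MeasurableSet B) : ∫⁻ u in Ioo (0 : ℝ) 1, mTilde μ ν πp πm u B = ν B := by
  have := hd.isFiniteKernel_activeKernel
  have hind : Measurable (B.indicator (1 : ℝ → ENNReal)) := measurable_one.indicator hB
  have hmoved : Measurable fun p : ℝ × ℝ => B.indicator (1 : ℝ → ENNReal) (quantile ν p.2) :=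
    hind.comp ((measurable_quantile ν).comp measurable_snd)
  let kept := fun u => ∫⁻ v, ENNReal.ofReal (weight μ ν u v) * B.indicator 1 (quantile ν u)
    ∂(activeKernel μ ν πp πm u)
  let moved := fun u => ∫⁻ v, ENNReal.ofReal (weight μ ν u v) * B.indicator 1 (quantile ν v)
    ∂(activeKernel μ ν πp πm u)
  have hw := (measurable_weight μ ν).ennreal_ofReal
  have hm_kept : Measurable kept :=
    (hw.mul (hmoved.comp measurable_swap)).lintegral_kernel_prod_right'
  have hm_moved : Measurable moved := (hw.mul hmoved).lintegral_kernel_prod_right'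
  have hexchange : ∫⁻ u in Ioo (0 : ℝ) 1, kept u = ∫⁻ u in Ioo (0 : ℝ) 1, moved u :=
    hd.lintegral_weight_activeKernel_swap hQ h hmoved
  have hfin : ∫⁻ u in Ioo (0 : ℝ) 1, moved u ≠ ⊤ :=
    hd.lintegral_weight_activeKernel_ne_top hQ h
      (F := fun p => B.indicator 1 (quantile ν p.2)) fun p =>
        indicator_le_self' (fun _ _ => zero_le) (quantile ν p.2)
  have hν : ∫⁻ u in Ioo (0 : ℝ) 1, B.indicator (1 : ℝ → ENNReal) (quantile ν u) = ν B := by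
    rw [← lintegral_map hind (measurable_quantile ν), map_quantile, lintegral_indicator_one hB]
  have hbalance : ∫⁻ u in Ioo (0 : ℝ) 1, (mTilde μ ν πp πm u B + kept u)
      = ∫⁻ u in Ioo (0 : ℝ) 1, (B.indicator 1 (quantile ν u) + moved u) :=
    lintegral_congr_ae ((hd.ae_mTildeSplit hQ h).mono fun u hu => hu.apply_add hB)
  rw [lintegral_add_right _ hm_kept, lintegral_add_right _ hm_moved, hexchange, hν] at hbalance
  exact (ENNReal.add_left_inj hfin).1 hbalance

end Marginal

/-! ### From kernels on `(0, 1)` to kernels on `ℝ` -/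

section LeftLimCdf

variable {μ : Measure ℝ} {x u : ℝ}

lemma leftLim_cdf_nonneg (μ : Measure ℝ) (x : ℝ) : 0 ≤ Function.leftLim (cdf μ) x :=
  (cdf_nonneg μ (x - 1)).trans ((monotone_cdf μ).le_leftLim (sub_one_lt x))

lemma leftLim_cdf_le_cdf (μ : Measure ℝ) (x : ℝ) : Function.leftLim (cdf μ) x ≤ cdf μ x :=
  (monotone_cdf μ).leftLim_le le_rfl

lemma leftLim_cdf_le_of_le_quantile (hu : u ∈ Ioo (0 : ℝ) 1) (h : x ≤ quantile μ u) :
    Function.leftLim (cdf μ) x ≤ u := by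
  refine le_of_tendsto ((monotone_cdf μ).tendsto_leftLim x) ?_
  filter_upwards [self_mem_nhdsWithin] with y hy
  exact ((lt_quantile_iff hu).1 (lt_of_lt_of_le hy h)).le

lemma le_quantile_of_leftLim_cdf_lt (hu : u ∈ Ioo (0 : ℝ) 1)
    (h : Function.leftLim (cdf μ) x < u) : x ≤ quantile μ u := by
  by_contra! hlt
  have hle : u ≤ cdf μ (quantile μ u) := (quantile_le_iff hu).1 le_rfl
  exact (hle.trans ((monotone_cdf μ).le_leftLim hlt)).not_gt h

lemma cdf_quantile_ne_zero_and_leftLim_ne_one (hu : u ∈ Ioo (0 : ℝ) 1) :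
    ¬(cdf μ (quantile μ u) = 0 ∨ Function.leftLim (cdf μ) (quantile μ u) = 1) := by
  rintro (h | h)
  · exact (hu.1.trans_le ((quantile_le_iff (μ := μ) hu).1 le_rfl)).ne' h
  · exact ((leftLim_cdf_le_of_le_quantile (μ := μ) hu le_rfl).trans_lt hu.2).ne h

lemma preimage_quantile_singleton_ae_eq (μ : Measure ℝ) (x : ℝ) :
    (quantile μ ⁻¹' {x} ∩ Ioo 0 1 : Set ℝ)
      =ᵐ[volume] Ioc (Function.leftLim (cdf μ) x) (cdf μ x) := by
  filter_upwards [Measure.ae_ne volume (Function.leftLim (cdf μ) x),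
    Measure.ae_ne volume (1 : ℝ)] with u hne_left hne_one
  refine propext ⟨fun ⟨hx, hu⟩ => ?_, fun h => ?_⟩
  · exact ⟨(leftLim_cdf_le_of_le_quantile hu (mem_singleton_iff.1 hx).ge).lt_of_ne hne_left.symm,
      (quantile_le_iff hu).1 (mem_singleton_iff.1 hx).le⟩
  · have hu : u ∈ Ioo (0 : ℝ) 1 :=
      ⟨(leftLim_cdf_nonneg μ x).trans_lt h.1, (h.2.trans (cdf_le_one μ x)).lt_of_ne hne_one⟩
    exact ⟨le_antisymm ((quantile_le_iff hu).2 h.2) (le_quantile_of_leftLim_cdf_lt hu h.1), hu⟩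

variable [IsProbabilityMeasure μ]

lemma measure_singleton_eq_ofReal_cdf_sub (μ : Measure ℝ) [IsProbabilityMeasure μ] (x : ℝ) :
    μ {x} = ENNReal.ofReal (cdf μ x - Function.leftLim (cdf μ) x) := by
  conv_lhs => rw [← measure_cdf μ]
  exact (cdf μ).measure_singleton x

lemma leftLim_cdf_eq_of_measure_singleton (h : ¬0 < μ {x}) :
    Function.leftLim (cdf μ) x = cdf μ x := by
  rw [measure_singleton_eq_ofReal_cdf_sub, ENNReal.ofReal_pos, not_lt, sub_nonpos] at h
  exact le_antisymm (leftLim_cdf_le_cdf μ x) h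

lemma countable_atoms {α : Type*} [MeasurableSpace α] [MeasurableSingletonClass α] (μ : Measure α)
    [SFinite μ] : {x | 0 < μ {x}}.Countable :=
  Measure.countable_meas_pos_of_disjoint_iUnion measurableSet_singleton
    fun _ _ h => disjoint_singleton.2 h

lemma cdf_quantile_of_measure_singleton (hu : u ∈ Ioo (0 : ℝ) 1)
    (h : ¬0 < μ {quantile μ u}) : cdf μ (quantile μ u) = u :=
  le_antisymm
    ((leftLim_cdf_eq_of_measure_singleton h).symm.trans_le
      (leftLim_cdf_le_of_le_quantile hu le_rfl))
    ((quantile_le_iff hu).1 le_rfl)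

lemma cdf_ne_zero_and_leftLim_ne_one_of_pos (hx : 0 < μ {x}) :
    ¬(cdf μ x = 0 ∨ Function.leftLim (cdf μ) x = 1) := by
  rw [measure_singleton_eq_ofReal_cdf_sub, ENNReal.ofReal_pos, sub_pos] at hx
  rintro (h | h)
  · exact (leftLim_cdf_nonneg μ x).not_gt (h ▸ hx)
  · exact (cdf_le_one μ x).not_gt (h ▸ hx)

lemma cdf_mem_Ioo_of_measure_singleton
    (hx : ¬(cdf μ x = 0 ∨ Function.leftLim (cdf μ) x = 1)) (h : ¬0 < μ {x}) :
    cdf μ x ∈ Ioo (0 : ℝ) 1 := by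
  rw [leftLim_cdf_eq_of_measure_singleton h, not_or] at hx
  exact ⟨(cdf_nonneg μ x).lt_of_ne (Ne.symm hx.1), (cdf_le_one μ x).lt_of_ne hx.2⟩

end LeftLimCdf

section GrandKernel

variable {μ : Measure ℝ} [IsProbabilityMeasure μ] {x u : ℝ}

lemma grandM_congr {mt mt' : ℝ → Measure ℝ} (h : ∀ u ∈ Ioo (0 : ℝ) 1, mt u = mt' u) (x : ℝ) :
    grandM μ mt x = grandM μ mt' x := by
  unfold grandM
  split_ifs with hdeg hatom
  · rfl
  · congr 1
    refine Measure.bind_congr_right ?_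
    filter_upwards [ae_restrict_mem measurableSet_Ioc,
      ae_restrict_of_ae (Measure.ae_ne volume (1 : ℝ))] with u hu hne
    exact h u ⟨(leftLim_cdf_nonneg μ x).trans_lt hu.1,
      (hu.2.trans (cdf_le_one μ x)).lt_of_ne hne⟩
  · exact h _ (cdf_mem_Ioo_of_measure_singleton hdeg hatom)

lemma grandM_quantile_of_measure_singleton (mt : ℝ → Measure ℝ) (hu : u ∈ Ioo (0 : ℝ) 1)
    (h : ¬0 < μ {quantile μ u}) : grandM μ mt (quantile μ u) = mt u := by
  rw [grandM, if_neg (cdf_quantile_ne_zero_and_leftLim_ne_one hu), if_neg h,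
    cdf_quantile_of_measure_singleton hu h]

variable (k : Kernel ℝ ℝ)

lemma grandM_apply_of_pos (hx : 0 < μ {x}) {B : Set ℝ} (hB : MeasurableSet B) :
    grandM μ k x B
      = (μ {x})⁻¹ * ∫⁻ u in Ioc (Function.leftLim (cdf μ) x) (cdf μ x), k u B := by
  rw [grandM, if_neg (cdf_ne_zero_and_leftLim_ne_one_of_pos hx), if_pos hx, Measure.smul_apply,
    smul_eq_mul, Measure.bind_apply hB k.measurable.aemeasurable]

lemma measurable_grandM : Measurable (grandM μ k) := by
  classical
  have hdeg : MeasurableSet {x | cdf μ x = 0 ∨ Function.leftLim (cdf μ) x = 1} :=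
    ((monotone_cdf μ).measurable (measurableSet_singleton 0)).union
      ((monotone_cdf μ).leftLim.measurable (measurableSet_singleton 1))
  have hdiffuse : Measurable fun x => if cdf μ x = 0 ∨ Function.leftLim (cdf μ) x = 1 then
      Measure.dirac x else k (cdf μ x) :=
    Measurable.ite hdeg Measure.measurable_dirac (k.measurable.comp (monotone_cdf μ).measurable)
  refine hdiffuse.measurable_of_countable_ne ((countable_atoms μ).mono fun x hne => ?_)
  by_contra hatom
  have hnotatom : ¬0 < μ {x} := hatom
  exact hne (by simp only [grandM, if_neg hnotatom])

lemma isProbabilityMeasure_grandM [IsMarkovKernel k] (x : ℝ) :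
    IsProbabilityMeasure (grandM μ k x) := by
  by_cases hatom : 0 < μ {x}
  · refine ⟨?_⟩
    simp only [grandM_apply_of_pos k hatom MeasurableSet.univ, measure_univ, setLIntegral_one,
      Real.volume_Ioc, ← measure_singleton_eq_ofReal_cdf_sub]
    exact ENNReal.inv_mul_cancel hatom.ne' (measure_ne_top μ _)
  · rw [grandM, if_neg hatom]
    split_ifs <;> infer_instance

/-- `grandM` as a kernel on `ℝ`, for a kernel on `(0, 1)` extended to `ℝ`. -/
def grandKernel (μ : Measure ℝ) [IsProbabilityMeasure μ] (k : Kernel ℝ ℝ) : Kernel ℝ ℝ where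
  toFun := grandM μ k
  measurable' := measurable_grandM k

instance isMarkovKernel_grandKernel [IsMarkovKernel k] : IsMarkovKernel (grandKernel μ k) :=
  ⟨isProbabilityMeasure_grandM k⟩

lemma setLIntegral_grandM_preimage_singleton (hx : 0 < μ {x}) {B : Set ℝ}
    (hB : MeasurableSet B) :
    ∫⁻ u in quantile μ ⁻¹' {x}, grandM μ k (quantile μ u) B ∂(volume.restrict (Ioo 0 1))
      = ∫⁻ u in quantile μ ⁻¹' {x}, k u B ∂(volume.restrict (Ioo 0 1)) := by
  have hs : MeasurableSet (quantile μ ⁻¹' {x}) := measurable_quantile μ (measurableSet_singleton x)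
  have hconst : ∫⁻ u in quantile μ ⁻¹' {x}, grandM μ k (quantile μ u) B
        ∂(volume.restrict (Ioo 0 1))
      = ∫⁻ _ in quantile μ ⁻¹' {x}, grandM μ k x B ∂(volume.restrict (Ioo 0 1)) :=
    setLIntegral_congr_fun hs fun u hu => by rw [mem_singleton_iff.1 hu]
  rw [hconst, setLIntegral_const, Measure.restrict_restrict hs,
    Measure.restrict_congr_set (preimage_quantile_singleton_ae_eq μ x), Measure.restrict_apply hs,
    measure_congr (preimage_quantile_singleton_ae_eq μ x), Real.volume_Ioc,
    ← measure_singleton_eq_ofReal_cdf_sub, grandM_apply_of_pos k hx hB, mul_comm, ← mul_assoc,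
    ENNReal.mul_inv_cancel hx.ne' (measure_ne_top μ _), one_mul]

lemma setLIntegral_grandM_preimage_of_subset_atoms {A : Set ℝ} (hA : A ⊆ {x | 0 < μ {x}})
    {B : Set ℝ} (hB : MeasurableSet B) :
    ∫⁻ u in quantile μ ⁻¹' A, grandM μ k (quantile μ u) B ∂(volume.restrict (Ioo 0 1))
      = ∫⁻ u in quantile μ ⁻¹' A, k u B ∂(volume.restrict (Ioo 0 1)) := by
  have hcount : A.Countable := (countable_atoms μ).mono hA
  have hdisj : A.PairwiseDisjoint fun x => quantile μ ⁻¹' {x} := fun x _ y _ hxy =>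
    Disjoint.preimage _ (disjoint_singleton.2 hxy)
  have hmeas : ∀ x ∈ A, MeasurableSet (quantile μ ⁻¹' {x}) := fun x _ =>
    measurable_quantile μ (measurableSet_singleton x)
  rw [← biUnion_preimage_singleton, lintegral_biUnion hcount hmeas hdisj,
    lintegral_biUnion hcount hmeas hdisj]
  exact tsum_congr fun x => setLIntegral_grandM_preimage_singleton k (hA x.2) hB

lemma setLIntegral_grandM_preimage {A B : Set ℝ} (hA : MeasurableSet A) (hB : MeasurableSet B) :
    ∫⁻ u in quantile μ ⁻¹' A, grandM μ k (quantile μ u) B ∂(volume.restrict (Ioo 0 1))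
      = ∫⁻ u in quantile μ ⁻¹' A, k u B ∂(volume.restrict (Ioo 0 1)) := by
  have hD : MeasurableSet {x | 0 < μ {x}} := (countable_atoms μ).measurableSet
  have hmeas : MeasurableSet (quantile μ ⁻¹' (A \ {x | 0 < μ {x}})) :=
    measurable_quantile μ (hA.diff hD)
  rw [← lintegral_inter_add_sdiff _ _ (measurable_quantile μ hD),
    ← lintegral_inter_add_sdiff (fun u => k u B) _ (measurable_quantile μ hD),
    ← preimage_inter, ← preimage_sdiff,
    setLIntegral_grandM_preimage_of_subset_atoms k inter_subset_right hB]
  congr 1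
  rw [Measure.restrict_restrict hmeas]
  refine setLIntegral_congr_fun (hmeas.inter measurableSet_Ioo) fun u hu => ?_
  rw [grandM_quantile_of_measure_singleton _ hu.2 hu.1.2]

lemma comp_grandKernel_restrict {A : Set ℝ} (hA : MeasurableSet A) :
    grandKernel μ k ∘ₘ μ.restrict A
      = k ∘ₘ (volume.restrict (Ioo (0 : ℝ) 1)).restrict (quantile μ ⁻¹' A) := by
  ext B hB
  rw [Measure.bind_apply hB (Kernel.aemeasurable _), Measure.bind_apply hB (Kernel.aemeasurable _),
    ← setLIntegral_grandM_preimage k hA hB]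
  have hmap := setLIntegral_map (μ := volume.restrict (Ioo (0 : ℝ) 1)) hA
    ((grandKernel μ k).measurable_coe hB) (measurable_quantile μ)
  rw [map_quantile] at hmap
  exact hmap

lemma comp_grandKernel : grandKernel μ k ∘ₘ μ = k ∘ₘ volume.restrict (Ioo (0 : ℝ) 1) := by
  simpa using comp_grandKernel_restrict k (μ := μ) MeasurableSet.univ

end GrandKernel

section Comp

variable {α β : Type*} [MeasurableSpace α] [MeasurableSpace β] {ρ : Measure α} {κ : Kernel α β}
  {f : β → ℝ}

lemma integrable_integral_of_integrable_comp (hf : Integrable f (κ ∘ₘ ρ)) :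
    Integrable (fun x => ∫ y, f y ∂(κ x)) ρ := by
  rw [Measure.comp_eq_comp_const_apply] at hf
  simpa using hf.integral_comp

lemma integral_measure_comp (hf : Integrable f (κ ∘ₘ ρ)) :
    ∫ y, f y ∂(κ ∘ₘ ρ) = ∫ x, ∫ y, f y ∂(κ x) ∂ρ := by
  rw [Measure.comp_eq_comp_const_apply] at hf ⊢
  simpa using Kernel.integral_comp hf

lemma comp_restrict_le (ρ : Measure α) (κ : Kernel α β) (s : Set α) :
    κ ∘ₘ ρ.restrict s ≤ κ ∘ₘ ρ := by
  refine Measure.le_intro fun B hB _ => ?_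
  rw [Measure.bind_apply hB (Kernel.aemeasurable _), Measure.bind_apply hB (Kernel.aemeasurable _)]
  exact setLIntegral_le_lintegral s _

end Comp

lemma ae_integral_grandKernel_le {μ : Measure ℝ} [IsProbabilityMeasure μ]
    (hμ : Integrable (fun x : ℝ => x) μ) {k : Kernel ℝ ℝ}
    (hk : Integrable (fun y : ℝ => y) (k ∘ₘ volume.restrict (Ioo (0 : ℝ) 1)))
    (hle : ∀ᵐ u ∂(volume.restrict (Ioo (0 : ℝ) 1)), ∫ y, y ∂(k u) ≤ quantile μ u) :
    ∀ᵐ x ∂μ, ∫ y, y ∂(grandKernel μ k x) ≤ x := by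
  have hint : Integrable (fun y : ℝ => y) (grandKernel μ k ∘ₘ μ) := by rwa [comp_grandKernel]
  refine ae_le_of_forall_setIntegral_le (integrable_integral_of_integrable_comp hint) hμ
    fun A hA _ => ?_
  calc ∫ x in A, ∫ y, y ∂(grandKernel μ k x) ∂μ
      = ∫ y, y ∂(grandKernel μ k ∘ₘ μ.restrict A) :=
        (integral_measure_comp (hint.mono_measure (comp_restrict_le _ _ _))).symm
    _ = ∫ u in quantile μ ⁻¹' A, ∫ y, y ∂(k u) ∂(volume.restrict (Ioo (0 : ℝ) 1)) := by
        rw [comp_grandKernel_restrict k hA,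
          integral_measure_comp (hk.mono_measure (comp_restrict_le _ _ _))]
    _ ≤ ∫ u in quantile μ ⁻¹' A, quantile μ u ∂(volume.restrict (Ioo (0 : ℝ) 1)) :=
        integral_mono_ae (integrable_integral_of_integrable_comp hk).integrableOn
          (integrable_quantile hμ).integrableOn (ae_restrict_of_ae hle)
    _ = ∫ x in A, x ∂μ := by
        conv_rhs => rw [← map_quantile μ]
        exact (setIntegral_map (f := fun x : ℝ => x) hA aestronglyMeasurable_id
          (measurable_quantile μ).aemeasurable).symm

lemma isSupermartingaleCoupling_grandKernel {μ ν : Measure ℝ} [IsProbabilityMeasure μ]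
    (hμ : Integrable (fun x : ℝ => x) μ) (hν : Integrable (fun x : ℝ => x) ν) {k : Kernel ℝ ℝ}
    [IsMarkovKernel k] (hk : k ∘ₘ volume.restrict (Ioo (0 : ℝ) 1) = ν)
    (hle : ∀ᵐ u ∂(volume.restrict (Ioo (0 : ℝ) 1)), ∫ y, y ∂(k u) ≤ quantile μ u) :
    IsSupermartingaleCoupling (μ ⊗ₘ grandKernel μ k) μ ν := by
  have hcomp : grandKernel μ k ∘ₘ μ = ν := (comp_grandKernel k).trans hk
  have hint : ∀ᵐ x ∂μ, Integrable (fun y : ℝ => y) (grandKernel μ k x) :=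
    Measure.ae_integrable_of_integrable_comp (hcomp.symm ▸ hν)
  exact ⟨⟨Measure.fst_compProd _ _, (Measure.snd_compProd _ _).trans hcomp⟩, grandKernel μ k,
    inferInstance, rfl, hint.and (ae_integral_grandKernel_le hμ (hk.symm ▸ hν) hle)⟩

/-! ### The supermartingale coupling attached to `Q` -/

lemma exists_subMarkov_disintegration {α Ω : Type*} [MeasurableSpace α] [MeasurableSpace Ω]
    [StandardBorelSpace Ω] [Nonempty Ω] (P : Measure (α × Ω)) [IsFiniteMeasure P] {s : Set Ω}
    (hs : MeasurableSet s) (hP : ∀ᵐ p ∂P, p.2 ∈ s) :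
    ∃ π : Kernel α Ω, (∀ a, π a univ ≤ 1) ∧ (∀ a, π a sᶜ = 0) ∧ P = P.map Prod.fst ⊗ₘ π := by
  refine ⟨P.condKernel.restrict hs, fun a => ?_, fun a => ?_, ?_⟩
  · rw [Kernel.restrict_apply]
    exact (Measure.restrict_apply_univ s).le.trans prob_le_one
  · simp [Kernel.restrict_apply, Measure.restrict_apply hs.compl]
  · have hdis : P.fst ⊗ₘ P.condKernel = P := P.disintegrate P.condKernel
    have hP' : ∀ᵐ p ∂(P.fst ⊗ₘ P.condKernel), p.2 ∈ s := by rwa [hdis]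
    conv_lhs => rw [← hdis]
    refine Measure.compProd_congr ?_
    filter_upwards [Measure.ae_ae_of_ae_compProd hP'] with a ha
    rw [Kernel.restrict_apply, Measure.restrict_eq_self_of_ae_mem ha]

section SupermartingaleCoupling

variable {μ ν : Measure ℝ} {Q : Measure (ℝ × ℝ)} {πp πm : Kernel ℝ ℝ}

lemma IsQd.exists_isDisintegration (hQ : IsQd μ ν Q) :
    ∃ πp πm : Kernel ℝ ℝ, IsDisintegration μ ν Q πp πm := by
  have := hQ.prob
  have hswap : ∀ᵐ p ∂(Q.map Prod.swap), p.2 ∈ Ioo 0 (uD μ ν) :=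
    (ae_map_iff measurable_swap.aemeasurable (measurable_snd measurableSet_Ioo)).2
      (hQ.ae_mem.mono fun p hp => hp.1)
  have hsnd : (Q.map Prod.swap).map Prod.fst = rhoMinus μ ν :=
    (Measure.map_map measurable_fst measurable_swap).trans hQ.snd_eq
  obtain ⟨πp, hp_le, hp_supp, hp_eq⟩ := exists_subMarkov_disintegration Q measurableSet_Ioo
    (hQ.ae_mem.mono fun p hp => hp.2.1)
  obtain ⟨πm, hm_le, hm_supp, hm_eq⟩ := exists_subMarkov_disintegration (Q.map Prod.swap)
    measurableSet_Ioo hswap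
  rw [hQ.fst_eq] at hp_eq
  rw [hsnd] at hm_eq
  refine ⟨πp, πm, hp_le, hp_supp, hm_le, hm_supp, hp_eq, ?_⟩
  rw [← hm_eq, Measure.map_map measurable_swap measurable_swap, Prod.swap_swap_eq, Measure.map_id]

/-- `m̃^Q` as a kernel on `ℝ`. -/
def IsDisintegration.mTildeKernel (hd : IsDisintegration μ ν Q πp πm) : Kernel ℝ ℝ where
  toFun := mTilde μ ν πp πm
  measurable' :=
    have := hd.isFiniteKernel_plus
    have := hd.isFiniteKernel_minus
    measurable_mTilde μ ν πp πm

lemma IsDisintegration.isMarkovKernel_mTildeKernel (hd : IsDisintegration μ ν Q πp πm) :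
    IsMarkovKernel hd.mTildeKernel :=
  ⟨isProbabilityMeasure_mTilde hd.plus_le hd.minus_le⟩

lemma IsDisintegration.comp_mTildeKernel [IsProbabilityMeasure ν]
    (hd : IsDisintegration μ ν Q πp πm) (hQ : IsQd μ ν Q) (h : GapDominated μ ν) :
    hd.mTildeKernel ∘ₘ volume.restrict (Ioo (0 : ℝ) 1) = ν := by
  ext B hB
  rw [Measure.bind_apply hB (Kernel.aemeasurable _)]
  exact hd.lintegral_mTilde_apply hQ h hB

lemma IsDisintegration.exists_isSupermartingaleCoupling [IsProbabilityMeasure μ]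
    [IsProbabilityMeasure ν] (hμ : Integrable (fun x : ℝ => x) μ)
    (hν : Integrable (fun x : ℝ => x) ν) (hd : IsDisintegration μ ν Q πp πm) (hQ : IsQd μ ν Q)
    (h : GapDominated μ ν) :
    ∃ m : Kernel ℝ ℝ, IsMarkovKernel m ∧ (∀ x, m x = grandM μ (mTilde μ ν πp πm) x) ∧
      IsSupermartingaleCoupling (μ ⊗ₘ m) μ ν := by
  have := hd.isMarkovKernel_mTildeKernel
  exact ⟨grandKernel μ hd.mTildeKernel, inferInstance, fun _ => rfl,
    isSupermartingaleCoupling_grandKernel hμ hν (hd.comp_mTildeKernel hQ h)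
      ((hd.ae_mTildeSplit hQ h).mono fun _ hu => hu.integral_le)⟩

end SupermartingaleCoupling

/-! ### The inverse transform supermartingale coupling -/

section ITS

variable {μ ν : Measure ℝ} {u v : ℝ}

lemma compProd_eq_map_of_ae_eq_dirac {α β : Type*} [MeasurableSpace α] [MeasurableSpace β]
    {ρ : Measure α} [SFinite ρ] {κ : Kernel α β} [IsSFiniteKernel κ] {f : α → β}
    (hf : Measurable f) (h : ∀ᵐ a ∂ρ, κ a = Measure.dirac (f a)) :
    ρ ⊗ₘ κ = ρ.map fun a => (a, f a) := by
  rw [← Measure.compProd_deterministic hf]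
  refine Measure.compProd_congr ?_
  filter_upwards [h] with a ha
  rw [ha, Kernel.deterministic_apply]

lemma dirac_apply_eq_one_iff {s : Set ℝ} : Measure.dirac u s = 1 ↔ u ∈ s := by
  rw [Measure.dirac_apply, indicator_eq_one_iff_mem]

lemma mixture_dirac (μ ν : Measure ℝ) (u v : ℝ) :
    mixture μ ν u (Measure.dirac v)
      = ENNReal.ofReal (coweight μ ν u v) • Measure.dirac (quantile ν u)
        + ENNReal.ofReal (weight μ ν u v) • Measure.dirac (quantile ν v) := by
  ext B hB
  rw [mixture_apply hB, lintegral_dirac, lintegral_dirac, add_comm, Measure.add_apply,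
    Measure.smul_apply, Measure.smul_apply, Measure.dirac_apply' _ hB, Measure.dirac_apply' _ hB,
    smul_eq_mul, smul_eq_mul]

lemma piITSPlus_univ_le_one (μ ν : Measure ℝ) (u : ℝ) : piITSPlus μ ν u univ ≤ 1 := by
  unfold piITSPlus
  split_ifs <;> simp

lemma piITSMinus_univ_le_one (μ ν : Measure ℝ) (v : ℝ) : piITSMinus μ ν v univ ≤ 1 := by
  unfold piITSMinus
  split_ifs <;> simp

lemma piITSPlus_compl_Ioo (μ ν : Measure ℝ) (u : ℝ) : piITSPlus μ ν u (Ioo 0 1)ᶜ = 0 := by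
  unfold piITSPlus
  split_ifs with hu
  · rw [Measure.dirac_apply, indicator_of_notMem (not_not.2 hu.2)]
  · rfl

lemma piITSMinus_compl_Ioo (μ ν : Measure ℝ) (v : ℝ) :
    piITSMinus μ ν v (Ioo 0 (uD μ ν))ᶜ = 0 := by
  unfold piITSMinus
  split_ifs with hv
  · rw [Measure.dirac_apply, indicator_of_notMem (not_not.2 hv.2)]
  · rfl

namespace GapDominated

lemma QITS_eq_map (h : GapDominated μ ν) :
    QITS μ ν = (rhoPlus μ ν).map fun u => (u, phi μ ν u) := by
  rw [QITS, Measure.restrict_eq_self_of_ae_mem (s := {u | 0 < phi μ ν u ∧ phi μ ν u < 1})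
    (h.ae_phi_mem_carrierMinus.mono fun _ hu => hu.1)]

lemma QITS_eq_map_phiTilde (h : GapDominated μ ν) :
    QITS μ ν = (rhoMinus μ ν).map fun v => (phiTilde μ ν v, v) := by
  have hphi := measurable_phi h.integrable h.integrable_swap
  have hphiTilde := measurable_phiTilde h.integrable h.integrable_swap
  rw [h.QITS_eq_map, ← h.map_phi_rhoPlus,
    Measure.map_map (g := fun v => (phiTilde μ ν v, v)) (hphiTilde.prodMk measurable_id) hphi]
  refine Measure.map_congr (h.ae_phiTilde_phi.mono fun u hu => ?_)
  rw [Function.comp_apply, hu]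

lemma QITS_mem_Qd (h : GapDominated μ ν) (hpos : 0 < uD μ ν) : QITS μ ν ∈ Qd μ ν := by
  have := h.isProbabilityMeasure_rhoPlus hpos
  have hgraph : Measurable fun u => (u, phi μ ν u) :=
    measurable_id.prodMk (measurable_phi h.integrable h.integrable_swap)
  have hprob : IsProbabilityMeasure (QITS μ ν) :=
    h.QITS_eq_map ▸ Measure.isProbabilityMeasure_map hgraph.aemeasurable
  refine ⟨hprob, ?_, ?_, ?_⟩
  · rw [h.QITS_eq_map, Measure.map_map measurable_fst hgraph]
    exact Measure.map_id
  · rw [h.QITS_eq_map, Measure.map_map measurable_snd hgraph]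
    exact h.map_phi_rhoPlus
  · rw [← mem_ae_iff_prob_eq_one (measurableSet_Qd_support μ ν), h.QITS_eq_map]
    refine (ae_map_iff hgraph.aemeasurable (measurableSet_Qd_support μ ν)).2 ?_
    filter_upwards [ae_rhoPlus_mem_carrierPlus μ ν, h.ae_phi_mem_carrierMinus] with u hu hphi
    exact ⟨hu.1, hphi.1, h.lt_phi hu⟩

/-- `π₊^{ITS}` as a kernel. -/
def kernelITSPlus (h : GapDominated μ ν) : Kernel ℝ ℝ where
  toFun := piITSPlus μ ν
  measurable' := by
    classical
    have hphi := measurable_phi h.integrable h.integrable_swap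
    have hs : MeasurableSet {u | u ∈ Ioo 0 (uD μ ν) ∧ 0 < phi μ ν u ∧ phi μ ν u < 1} :=
      measurableSet_Ioo.inter (hphi measurableSet_Ioo)
    exact Measurable.ite hs (Measure.measurable_dirac.comp hphi) measurable_const

/-- `π₋^{ITS}` as a kernel. -/
def kernelITSMinus (h : GapDominated μ ν) : Kernel ℝ ℝ where
  toFun := piITSMinus μ ν
  measurable' := by
    classical
    have hphiTilde := measurable_phiTilde h.integrable h.integrable_swap
    have hs : MeasurableSet
        {v | v ∈ Ioo (0 : ℝ) 1 ∧ 0 < phiTilde μ ν v ∧ phiTilde μ ν v < uD μ ν} :=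
      measurableSet_Ioo.inter (hphiTilde measurableSet_Ioo)
    exact Measurable.ite hs (Measure.measurable_dirac.comp hphiTilde) measurable_const

lemma ae_kernelITSPlus_eq_dirac (h : GapDominated μ ν) :
    ∀ᵐ u ∂(rhoPlus μ ν), h.kernelITSPlus u = Measure.dirac (phi μ ν u) := by
  filter_upwards [ae_rhoPlus_mem_carrierPlus μ ν, h.ae_phi_mem_carrierMinus] with u hu hphi
  exact if_pos ⟨hu.1, hphi.1⟩

lemma ae_kernelITSMinus_eq_dirac (h : GapDominated μ ν) :
    ∀ᵐ v ∂(rhoMinus μ ν), h.kernelITSMinus v = Measure.dirac (phiTilde μ ν v) := by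
  filter_upwards [ae_rhoMinus_mem_carrierMinus μ ν, h.ae_phiTilde_mem_carrierPlus] with v hv hphi
  exact if_pos ⟨hv.1, hphi.1⟩

lemma isDisintegration_QITS (h : GapDominated μ ν) (hpos : 0 < uD μ ν) :
    IsDisintegration μ ν (QITS μ ν) h.kernelITSPlus h.kernelITSMinus where
  plus_le := piITSPlus_univ_le_one μ ν
  plus_supp := piITSPlus_compl_Ioo μ ν
  minus_le := piITSMinus_univ_le_one μ ν
  minus_supp := piITSMinus_compl_Ioo μ ν
  eq_plus := by
    have := (h.QITS_mem_Qd hpos).isProbabilityMeasure_rhoPlus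
    have : IsFiniteKernel h.kernelITSPlus := isFiniteKernel_of_le_one (piITSPlus_univ_le_one μ ν)
    rw [h.QITS_eq_map, compProd_eq_map_of_ae_eq_dirac
      (measurable_phi h.integrable h.integrable_swap) h.ae_kernelITSPlus_eq_dirac]
  eq_minus := by
    have := (h.QITS_mem_Qd hpos).isProbabilityMeasure_rhoMinus
    have : IsFiniteKernel h.kernelITSMinus :=
      isFiniteKernel_of_le_one (piITSMinus_univ_le_one μ ν)
    have hphiTilde := measurable_phiTilde h.integrable h.integrable_swap
    rw [h.QITS_eq_map_phiTilde,
      compProd_eq_map_of_ae_eq_dirac hphiTilde h.ae_kernelITSMinus_eq_dirac,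
      Measure.map_map (f := fun v => (v, phiTilde μ ν v)) measurable_swap
        (measurable_id.prodMk hphiTilde)]
    rfl

lemma piITSPlus_eq_dirac (h : GapDominated μ ν) (hu : u ∈ carrierPlus μ ν)
    (hphi : phi μ ν u < 1) : piITSPlus μ ν u = Measure.dirac (phi μ ν u) :=
  if_pos ⟨hu.1, hu.1.1.trans (h.lt_phi hu), hphi⟩

lemma piITSMinus_eq_dirac (h : GapDominated μ ν) (hv : v ∈ carrierMinus μ ν)
    (hphi : phiTilde μ ν v < uD μ ν) : piITSMinus μ ν v = Measure.dirac (phiTilde μ ν v) :=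
  if_pos ⟨hv.1, h.phiTilde_pos hv, hphi⟩

lemma piITSPlus_apply_eq_one_iff (h : GapDominated μ ν) (hu : 0 < u) :
    (quantile ν u < quantile μ u ∧ u ∈ Ioo 0 (uD μ ν) ∧
      piITSPlus μ ν u {v | v ∈ Ioo (0 : ℝ) 1 ∧ quantile μ u < quantile ν v} = 1) ↔
    (u < uD μ ν ∧ quantile μ u < quantile ν (phi μ ν u) ∧ quantile ν u < quantile μ u ∧
      phi μ ν u < 1) := by
  constructor
  · rintro ⟨hgap, hmem, hone⟩
    by_cases hphi : phi μ ν u < 1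
    · rw [h.piITSPlus_eq_dirac ⟨hmem, hgap⟩ hphi, dirac_apply_eq_one_iff] at hone
      exact ⟨hmem.2, hone.2, hgap, hphi⟩
    · rw [piITSPlus, if_neg fun hc => hphi hc.2.2] at hone
      simp at hone
  · rintro ⟨hlt, hquantile, hgap, hphi⟩
    have hmem : u ∈ carrierPlus μ ν := ⟨⟨hu, hlt⟩, hgap⟩
    rw [h.piITSPlus_eq_dirac hmem hphi, dirac_apply_eq_one_iff]
    exact ⟨hgap, hmem.1, ⟨hu.trans (h.lt_phi hmem), hphi⟩, hquantile⟩

lemma piITSMinus_apply_eq_one_iff (h : GapDominated μ ν) (hv : v ∈ Ioo (0 : ℝ) 1) :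
    (quantile μ v < quantile ν v ∧ v ∈ Ioo (0 : ℝ) 1 ∧
      piITSMinus μ ν v {u | u ∈ Ioo (0 : ℝ) 1 ∧ quantile ν u < quantile μ v} = 1) ↔
    (quantile ν (phiTilde μ ν v) < quantile μ v ∧ quantile μ v < quantile ν v ∧
      phiTilde μ ν v < uD μ ν) := by
  constructor
  · rintro ⟨hgap, -, hone⟩
    by_cases hphi : phiTilde μ ν v < uD μ ν
    · rw [h.piITSMinus_eq_dirac ⟨hv, hgap⟩ hphi, dirac_apply_eq_one_iff] at hone
      exact ⟨hone.2, hgap, hphi⟩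
    · rw [piITSMinus, if_neg fun hc => hphi hc.2.2] at hone
      simp at hone
  · rintro ⟨hquantile, hgap, hphi⟩
    have hmem : v ∈ carrierMinus μ ν := ⟨hv, hgap⟩
    rw [h.piITSMinus_eq_dirac hmem hphi, dirac_apply_eq_one_iff]
    exact ⟨hgap, hv, ⟨h.phiTilde_pos hmem, hphi.trans_le h.uD_mem.2⟩, hquantile⟩

lemma mTilde_kernelITS (h : GapDominated μ ν) (hu : u ∈ Ioo (0 : ℝ) 1) :
    mTilde μ ν h.kernelITSPlus h.kernelITSMinus u = mTildeITS μ ν u := by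
  unfold mTilde mTildeITS
  refine ite_congr (propext (h.piITSPlus_apply_eq_one_iff hu.1))
    (fun ⟨hlt, hquantile, hgap, hphi⟩ => ?_) fun _ =>
      ite_congr (propext (h.piITSMinus_apply_eq_one_iff hu))
        (fun ⟨hquantile, hgap, hphi⟩ => ?_) fun _ => rfl
  · have hdirac : h.kernelITSPlus u = Measure.dirac (phi μ ν u) :=
      h.piITSPlus_eq_dirac ⟨⟨hu.1, hlt⟩, hgap⟩ hphi
    rw [hdirac, mixture_dirac, coweight_eq_one_sub_weight (hgap.trans hquantile).ne', weight]
  · have hdirac : h.kernelITSMinus u = Measure.dirac (phiTilde μ ν u) :=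
      h.piITSMinus_eq_dirac ⟨hu, hgap⟩ hphi
    rw [hdirac, mixture_dirac, coweight_eq_one_sub_weight (hquantile.trans hgap).ne,
      weight_eq_sub_swap_div_sub_swap]

lemma exists_isSupermartingaleCoupling_ITS [IsProbabilityMeasure μ] [IsProbabilityMeasure ν]
    (hμ : Integrable (fun x : ℝ => x) μ) (hν : Integrable (fun x : ℝ => x) ν)
    (h : GapDominated μ ν) (hpos : 0 < uD μ ν) :
    ∃ m : Kernel ℝ ℝ, IsMarkovKernel m ∧ (∀ x, m x = grandM μ (mTildeITS μ ν) x) ∧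
      IsSupermartingaleCoupling (μ ⊗ₘ m) μ ν := by
  obtain ⟨m, hm, hmx, hcoupling⟩ :=
    (h.isDisintegration_QITS hpos).exists_isSupermartingaleCoupling hμ hν (h.QITS_mem_Qd hpos) h
  exact ⟨m, hm, fun x => (hmx x).trans (grandM_congr (fun _ hu => h.mTilde_kernelITS hu) x),
    hcoupling⟩

end GapDominated

end ITS

/-! ### Reflection -/

section Reflect

variable {μ ν : Measure ℝ}

lemma reflect_reflect (μ : Measure ℝ) : reflect (reflect μ) = μ := by
  rw [reflect, reflect, Measure.map_map measurable_neg measurable_neg]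
  simp

lemma isProbabilityMeasure_reflect (μ : Measure ℝ) [IsProbabilityMeasure μ] :
    IsProbabilityMeasure (reflect μ) :=
  Measure.isProbabilityMeasure_map measurable_neg.aemeasurable

lemma integrable_reflect (hμ : Integrable (fun x : ℝ => x) μ) :
    Integrable (fun x : ℝ => x) (reflect μ) :=
  (integrable_map_measure aestronglyMeasurable_id measurable_neg.aemeasurable).2 hμ.neg

lemma integral_reflect (μ : Measure ℝ) : ∫ y, y ∂(reflect μ) = -∫ y, y ∂μ := by
  rw [reflect, integral_map (f := fun y : ℝ => y) measurable_neg.aemeasurable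
    aestronglyMeasurable_id, integral_neg]

lemma IcxLE.dcxLE_reflect (h : IcxLE μ ν) : DcxLE (reflect μ) (reflect ν) := by
  intro f hanti hconv hint
  have hf : Measurable f := hanti.measurable
  have hneg : Measurable fun x : ℝ => -x := measurable_neg
  have hmono : Monotone fun x => f (-x) := fun x y hxy => hanti (neg_le_neg hxy)
  have hconv' : ConvexOn ℝ univ fun x => f (-x) :=
    hconv.comp_linearMap (-LinearMap.id : ℝ →ₗ[ℝ] ℝ)
  obtain ⟨hintμ, hle⟩ := h _ hmono hconv'
    ((integrable_map_measure hf.aestronglyMeasurable hneg.aemeasurable).1 hint)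
  refine ⟨(integrable_map_measure hf.aestronglyMeasurable hneg.aemeasurable).2 hintμ, ?_⟩
  rwa [reflect, reflect, integral_map hneg.aemeasurable hf.aestronglyMeasurable,
    integral_map hneg.aemeasurable hf.aestronglyMeasurable]

/-- The conjugate `x ↦ reflect (m (-x))` of the kernel `m` by `x ↦ -x`. -/
def reflectKernel (m : Kernel ℝ ℝ) : Kernel ℝ ℝ :=
  (m.comap (fun x : ℝ => -x) measurable_neg).map fun x => -x

lemma reflectKernel_apply (m : Kernel ℝ ℝ) (x : ℝ) : reflectKernel m x = reflect (m (-x)) := by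
  rw [reflectKernel, Kernel.map_apply _ measurable_neg, Kernel.comap_apply, reflect]

lemma isMarkovKernel_reflectKernel (m : Kernel ℝ ℝ) [IsMarkovKernel m] :
    IsMarkovKernel (reflectKernel m) :=
  ⟨fun x => by rw [reflectKernel_apply]; exact isProbabilityMeasure_reflect _⟩

lemma reflect₂_compProd [IsProbabilityMeasure μ] (m : Kernel ℝ ℝ) [IsMarkovKernel m] :
    reflect₂ (reflect μ ⊗ₘ m) = μ ⊗ₘ reflectKernel m := by
  have := isProbabilityMeasure_reflect μ
  have := isMarkovKernel_reflectKernel m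
  have hneg : Measurable fun p : ℝ × ℝ => (-p.1, -p.2) := by fun_prop
  ext s hs
  rw [reflect₂, Measure.map_apply hneg hs, Measure.compProd_apply (hneg hs),
    Measure.compProd_apply hs, reflect, lintegral_map
      (Kernel.measurable_kernel_prodMk_left (hneg hs)) measurable_neg]
  refine lintegral_congr fun x => ?_
  rw [reflectKernel_apply, reflect, Measure.map_apply measurable_neg (measurable_prodMk_left hs)]
  congr 1
  ext y
  simp

lemma IsSupermartingaleCoupling.reflect₂ [IsProbabilityMeasure μ] {M : Measure (ℝ × ℝ)}
    (h : IsSupermartingaleCoupling M (reflect μ) (reflect ν)) :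
    IsSubmartingaleCoupling (reflect₂ M) μ ν := by
  have hneg : Measurable fun p : ℝ × ℝ => (-p.1, -p.2) := by fun_prop
  obtain ⟨m, hm, hM, hae⟩ := h.exists_kernel
  refine ⟨⟨?_, ?_⟩, reflectKernel m, isMarkovKernel_reflectKernel m, ?_, ?_⟩
  · rw [← reflect_reflect μ, ← h.fst_eq, ITCoupling.reflect₂, ITCoupling.reflect,
      Measure.map_map measurable_fst hneg, Measure.map_map measurable_neg measurable_fst]
    rfl
  · rw [← reflect_reflect ν, ← h.snd_eq, ITCoupling.reflect₂, ITCoupling.reflect,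
      Measure.map_map measurable_snd hneg, Measure.map_map measurable_neg measurable_snd]
    rfl
  · rw [hM]
    exact reflect₂_compProd m
  · filter_upwards [ae_of_ae_map measurable_neg.aemeasurable hae] with x hx
    rw [reflectKernel_apply]
    refine ⟨integrable_reflect hx.1, ?_⟩
    rw [integral_reflect]
    linarith [hx.2]

end Reflect

end ITCoupling

end

theorem mainTheorem10 (μ ν : Measure ℝ) [IsProbabilityMeasure μ] [IsProbabilityMeasure ν]
    (hμ : Integrable (fun x : ℝ => x) μ) (hν : Integrable (fun x : ℝ => x) ν) :
    -- decreasing convex order: supermartingale couplings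
    (DcxLE μ ν → 0 < uD μ ν →
      -- every element of `𝒬^d` can be disintegrated, and every choice of the disintegration
      -- kernels gives a supermartingale coupling
      (∀ Q ∈ Qd μ ν,
        (∃ πp πm : Kernel ℝ ℝ, IsDisintegration μ ν Q πp πm) ∧
        ∀ πp πm : Kernel ℝ ℝ, IsDisintegration μ ν Q πp πm →
          ∃ m : Kernel ℝ ℝ, IsMarkovKernel m ∧
            (∀ x, m x = grandM μ (mTilde μ ν πp πm) x) ∧
            IsSupermartingaleCoupling (μ ⊗ₘ m) μ ν) ∧
      -- the inverse transform supermartingale coupling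
      QITS μ ν ∈ Qd μ ν ∧
      ∃ πp πm : Kernel ℝ ℝ,
        (∀ u, πp u = piITSPlus μ ν u) ∧ (∀ v, πm v = piITSMinus μ ν v) ∧
        IsDisintegration μ ν (QITS μ ν) πp πm ∧
        (∀ u ∈ Ioo (0 : ℝ) 1, mTilde μ ν πp πm u = mTildeITS μ ν u) ∧
        ∃ m : Kernel ℝ ℝ, IsMarkovKernel m ∧
          (∀ x, m x = grandM μ (mTildeITS μ ν) x) ∧
          IsSupermartingaleCoupling (μ ⊗ₘ m) μ ν) ∧
    -- increasing convex order: submartingale couplings by reflection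
    (IcxLE μ ν →
      DcxLE (reflect μ) (reflect ν) ∧
      (∀ M : Measure (ℝ × ℝ), IsSupermartingaleCoupling M (reflect μ) (reflect ν) →
        IsSubmartingaleCoupling (reflect₂ M) μ ν) ∧
      (0 < uD (reflect μ) (reflect ν) →
        (∀ Q ∈ Qd (reflect μ) (reflect ν), ∀ πp πm : Kernel ℝ ℝ,
          IsDisintegration (reflect μ) (reflect ν) Q πp πm →
          ∃ m : Kernel ℝ ℝ, IsMarkovKernel m ∧
            (∀ x, m x = grandM (reflect μ) (mTilde (reflect μ) (reflect ν) πp πm) x) ∧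
            IsSubmartingaleCoupling (reflect₂ (reflect μ ⊗ₘ m)) μ ν) ∧
        ∃ m : Kernel ℝ ℝ, IsMarkovKernel m ∧
          (∀ x, m x = grandM (reflect μ) (mTildeITS (reflect μ) (reflect ν)) x) ∧
          IsSubmartingaleCoupling (reflect₂ (reflect μ ⊗ₘ m)) μ ν)) := by
  refine ⟨fun hdcx hpos => ?_, fun hicx => ?_⟩
  · have h := hdcx.gapDominated hμ hν
    exact ⟨fun Q hQ => ⟨IsQd.exists_isDisintegration hQ,
        fun πp πm hd => hd.exists_isSupermartingaleCoupling hμ hν hQ h⟩,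
      h.QITS_mem_Qd hpos, h.kernelITSPlus, h.kernelITSMinus, fun _ => rfl, fun _ => rfl,
      h.isDisintegration_QITS hpos, fun u hu => h.mTilde_kernelITS hu,
      h.exists_isSupermartingaleCoupling_ITS hμ hν hpos⟩
  · have := isProbabilityMeasure_reflect μ
    have := isProbabilityMeasure_reflect ν
    have hμ' := integrable_reflect hμ
    have hν' := integrable_reflect hν
    have hdcx := hicx.dcxLE_reflect
    have h := hdcx.gapDominated hμ' hν'
    refine ⟨hdcx, fun M hM => hM.reflect₂, fun hpos => ⟨fun Q hQ πp πm hd => ?_, ?_⟩⟩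
    · obtain ⟨m, hm, hmx, hs⟩ := hd.exists_isSupermartingaleCoupling hμ' hν' hQ h
      exact ⟨m, hm, hmx, hs.reflect₂⟩
    · obtain ⟨m, hm, hmx, hs⟩ := h.exists_isSupermartingaleCoupling_ITS hμ' hν' hpos
      exact ⟨m, hm, hmx, hs.reflect₂⟩
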